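/- All vector spaces are over $\mathbb C$; $|x|\in\mathbb Z/2$ denotes the parity of a homogeneous element $x$, and $\delta$ is the Kronecker delta. Let $\mathcal A=\mathbb C[t^{\pm1}]\otimes\Lambda(1)$, with $t$ even and $\xi$ odd, $\xi^2=0$, and let $\mathcal W$ be the Witt superalgebra, i.e. the Lie superalgebra of superderivations of $\mathcal A$. For $i\in\mathbb Z$ put $$d_i=t^{i+1}\tfrac{\partial}{\partial t},\quad h_i=t^i\xi\tfrac{\partial}{\partial\xi},\quad Q_i=t^i\tfrac{\partial}{\partial\xi},\quad G_i=t^{i+1}\xi\tfrac{\partial}{\partial t}.$$ Let $\mathfrak g=\mathfrak g_{\bar0}\oplus\mathfrak g_{\bar1}$ be a finite-dimensional perfect Lie superalgebra ($\mathfrak g=[\mathfrak g,\mathfrak g]$) and $\mathcal L=\mathcal W\ltimes(\mathfrak g\otimes\mathcal A)$, where $[x\otimes a,y\otimes b]=(-1)^{|a||y|}[x,y]\otimes ab$ and $[D,x\otimes a]=(-1)^{|D||x|}x\otimes D(a)$ for homogeneous $x,y\in\mathfrak g$, $a,b\in\mathcal A$, $D\in\mathcal W$. A 2-cocycle on $\mathcal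 L$ is a bilinear form $\alpha:\mathcal L\times\mathcal L\to\mathbb C$ with $\alpha(x,y)=-(-1)^{|x||y|}\alpha(y,x)$ and $\alpha(x,[y,z])=\alpha([x,y],z)+(-1)^{|x||y|}\alpha(y,[x,z])$ for homogeneous $x,y,z$; a 2-coboundary is a form $(x,y)\mapsto\rho([x,y])$ with $\rho:\mathcal L\to\mathbb C$ linear; $H^2(\mathcal L,\mathbb C)$ is the space of 2-cocycles modulo 2-coboundaries. A central extension of $\mathcal L$ is a surjective parity-preserving homomorphism of Lie superalgebras onto $\mathcal L$ whose kernel is central and purely even; it is universal if it admits a unique parity-preserving homomorphism over $\mathcal L$ to every central extension of $\mathcal L$. **Theorem.** $\dim H^2(\mathcal L,\mathbb C)=1$. The elements $d_i,h_i,Q_i,G_i$ $(i\in\mathbb Z)$ span $\mathcal W$. The universal central extension of $\mathcal L$ has a one-dimensional kernel: it is $\widehat{\mathcal L}=\mathcal L\oplus\mathbb C C$ with $C$ even and central, with the projection onto $\mathcal L$, and with the bracket $[x,y]+\alpha(x,y)C$ of $x,y\in\mathcal L$ for an even 2-cocycle $\alpha$ that vanishes whenever one of its arguments lies in $\mathfrak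 g\otimes\mathcal A$. For all $i,j\in\mathbb Z$ and homogeneous $x,y\in\mathfrak g$, the brackets of $\widehat{\mathcal L}$ are \begin{align*} &[d_i,d_j]=(j-i)d_{i+j},\quad [d_i,h_j]=jh_{i+j}-i^2\delta_{i+j,0}C,\quad [d_i,Q_j]=jQ_{i+j},\quad [d_i,G_j]=(j-i)G_{i+j},\\ &[h_i,h_j]=2i\,\delta_{i+j,0}C,\quad [h_i,Q_j]=-Q_{i+j},\quad [h_i,G_j]=G_{i+j},\quad [Q_i,G_j]=d_{i+j}+ih_{i+j}-i^2\delta_{i+j,0}C,\\ &[d_i,x\otimes t^j]=jx\otimes t^{i+j},\quad [d_i,x\otimes t^j\xi]=jx\otimes t^{i+j}\xi,\quad [h_i,x\otimes t^j\xi]=x\otimes t^{i+j}\xi,\\ &[Q_i,x\otimes t^j\xi]=(-1)^{|x|}x\otimes t^{i+j},\quad [G_i,x\otimes t^j]=(-1)^{|x|}jx\otimes t^{i+j}\xi,\\ &[x\otimes t^i,y\otimes t^j]=[x,y]\otimes t^{i+j},\quad [x\otimes t^i\xi,y\otimes t^j]=(-1)^{|y|}[x,y]\otimes t^{i+j}\xi,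 \end{align*} where all other brackets of these elements, up to supersymmetry, are zero. -/

import Mathlib

open scoped TensorProduct LaurentPolynomial

set_option linter.unusedSimpArgs false
set_option linter.unusedTactic false
set_option linter.unreachableTactic false

universe u v w

noncomputable section

/-! ### Lie superalgebras over the complex numbers -/

/-- The sign `(-1)^(pq)` for parities `p`, `q`. -/
def ksign (p q : ZMod 2) : ℂ := if p = 1 ∧ q = 1 then -1 else 1

/-- A Lie superalgebra structure on a complex vector space `V`. In the Jacobi identity only the
first two elements have to be homogeneous, as the third one enters linearly and without a sign. -/
structure LieSuperalgebra (V : Type u) [AddCommGroup V] [Module ℂ V] where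
  /-- the even part `par 0` and the odd part `par 1` -/
  par : ZMod 2 → Submodule ℂ V
  isCompl : IsCompl (par 0) (par 1)
  /-- the superbracket -/
  bracket : V →ₗ[ℂ] V →ₗ[ℂ] V
  bracket_mem : ∀ (p q : ZMod 2) (x y : V), x ∈ par p → y ∈ par q → bracket x y ∈ par (p + q)
  skew : ∀ (p q : ZMod 2) (x y : V), x ∈ par p → y ∈ par q →
    bracket x y = -(ksign p q • bracket y x)
  jacobi : ∀ (p q : ZMod 2) (x y z : V), x ∈ par p → y ∈ par q →
    bracket x (bracket y z) = bracket (bracket x y) z + ksign p q • bracket y (bracket x z)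

namespace LieSuperalgebra

section General

variable {V : Type u} [AddCommGroup V] [Module ℂ V] {E : Type v} [AddCommGroup E] [Module ℂ E]

/-- `V = [V, V]`. -/
def IsPerfect (S : LieSuperalgebra V) : Prop :=
  Submodule.span ℂ {z : V | ∃ x y : V, S.bracket x y = z} = ⊤

/-- The parity involution `x ↦ (-1)^|x| x`. -/
def parityMap (S : LieSuperalgebra V) : V →ₗ[ℂ] V :=
  Submodule.projection (S.par 0) (S.par 1) S.isCompl -
    Submodule.projection (S.par 1) (S.par 0) S.isCompl.symm

/-- Homomorphisms of Lie superalgebras: parity preserving linear maps that respect the bracket. -/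
structure IsHom (SV : LieSuperalgebra V) (SE : LieSuperalgebra E) (f : V →ₗ[ℂ] E) : Prop where
  map_par : ∀ (p : ZMod 2) (x : V), x ∈ SV.par p → f x ∈ SE.par p
  map_bracket : ∀ x y : V, f (SV.bracket x y) = SE.bracket (f x) (f y)

/-- `(E, τ)` is a central extension of `V`: the kernel of the surjective homomorphism `τ` is purely
even and central. -/
structure IsCentralExtension (SE : LieSuperalgebra E) (SV : LieSuperalgebra V) (τ : E →ₗ[ℂ] V) :
    Prop where
  isHom : IsHom SE SV τ
  surjective : Function.Surjective τ
  ker_even : LinearMap.ker τ ≤ SE.par 0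
  ker_central : ∀ c ∈ LinearMap.ker τ, ∀ x : E, SE.bracket c x = 0

/-- `(E, τ)` is a universal central extension of `V`: it has a unique homomorphism over `V` to every
central extension of `V` (on a vector space in the universe `w`). -/
def IsUniversalCentralExtension (SE : LieSuperalgebra E) (SV : LieSuperalgebra V)
    (τ : E →ₗ[ℂ] V) : Prop :=
  IsCentralExtension SE SV τ ∧
    ∀ (F : Type w) [AddCommGroup F] [Module ℂ F] (SF : LieSuperalgebra F) (ι : F →ₗ[ℂ] V),
      IsCentralExtension SF SV ι → ∃! ψ : E →ₗ[ℂ] F, IsHom SE SF ψ ∧ ι ∘ₗ ψ = τ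

/-- The space of 2-cocycles with values in `ℂ`. -/
def Z2 (S : LieSuperalgebra V) : Submodule ℂ (V →ₗ[ℂ] V →ₗ[ℂ] ℂ) where
  carrier := {α |
    (∀ (p q : ZMod 2) (x y : V), x ∈ S.par p → y ∈ S.par q → α x y = -(ksign p q * α y x)) ∧
    ∀ (p q : ZMod 2) (x y z : V), x ∈ S.par p → y ∈ S.par q →
      α x (S.bracket y z) = α (S.bracket x y) z + ksign p q * α y (S.bracket x z)}
  zero_mem' := by constructor <;> intros <;> simp
  add_mem' := by
    rintro α β ⟨h1, h2⟩ ⟨h3, h4⟩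
    refine ⟨fun p q x y hx hy => ?_, fun p q x y z hx hy => ?_⟩
    · simp only [LinearMap.add_apply, h1 p q x y hx hy, h3 p q x y hx hy]; ring
    · simp only [LinearMap.add_apply, h2 p q x y z hx hy, h4 p q x y z hx hy]; ring
  smul_mem' := by
    rintro c α ⟨h1, h2⟩
    refine ⟨fun p q x y hx hy => ?_, fun p q x y z hx hy => ?_⟩
    · simp only [LinearMap.smul_apply, smul_eq_mul, h1 p q x y hx hy]; ring
    · simp only [LinearMap.smul_apply, smul_eq_mul, h2 p q x y z hx hy]; ring

/-- The space of 2-coboundaries `(x, y) ↦ ρ [x, y]`. -/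
def B2 (S : LieSuperalgebra V) : Submodule ℂ (V →ₗ[ℂ] V →ₗ[ℂ] ℂ) where
  carrier := {α | ∃ ρ : V →ₗ[ℂ] ℂ, ∀ x y : V, α x y = ρ (S.bracket x y)}
  zero_mem' := ⟨0, by simp⟩
  add_mem' := by
    rintro α β ⟨ρ, h⟩ ⟨ρ₂, h₂⟩
    exact ⟨ρ + ρ₂, fun x y => by simp [h, h₂]⟩
  smul_mem' := by
    rintro c α ⟨ρ, h⟩
    exact ⟨c • ρ, fun x y => by simp [h]⟩

/-- Every coboundary is a cocycle. -/
theorem B2_le_Z2 (S : LieSuperalgebra V) : S.B2 ≤ S.Z2 := by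
  rintro α ⟨ρ, h⟩
  refine ⟨fun p q x y hx hy => ?_, fun p q x y z hx hy => ?_⟩
  · simp [h, S.skew p q x y hx hy]
  · simp [h, S.jacobi p q x y z hx hy]

/-- The second cohomology `H²(V, ℂ) = Z²(V, ℂ) / B²(V, ℂ)`, realized as the space of the classes
modulo `B²(V, ℂ)` of the cocycles, inside the quotient of all bilinear forms by `B²(V, ℂ)`. -/
abbrev H2 (S : LieSuperalgebra V) : Submodule ℂ ((V →ₗ[ℂ] V →ₗ[ℂ] ℂ) ⧸ S.B2) :=
  S.Z2.map S.B2.mkQ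

/-- The one-dimensional central extension `V ⊕ ℂ C` with an even central element `C = (0, 1)` and
the bracket `[x, y]₁ = [x, y] + α(x, y) C`, for an even 2-cocycle `α`. -/
def centralExtension (S : LieSuperalgebra V) (α : V →ₗ[ℂ] V →ₗ[ℂ] ℂ) (hα : α ∈ S.Z2)
    (heven : ∀ x ∈ S.par 0, ∀ y ∈ S.par 1, α x y = 0) : LieSuperalgebra (V × ℂ) where
  par p := (S.par p).prod (if p = 0 then ⊤ else ⊥)
  isCompl := by
    have h := S.isCompl
    constructor
    · rw [Submodule.disjoint_def]
      rintro ⟨x, c⟩ ⟨hx, -⟩ ⟨hy, hc⟩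
      have h1 := Submodule.disjoint_def.1 h.disjoint x hx hy
      have h2 : c = 0 := by simpa using hc
      simp [h1, h2]
    · rw [codisjoint_iff, eq_top_iff]
      rintro ⟨x, c⟩ -
      obtain ⟨a, ha, b, hb, rfl⟩ := Submodule.mem_sup.1
        (h.sup_eq_top ▸ Submodule.mem_top : x ∈ S.par 0 ⊔ S.par 1)
      exact Submodule.mem_sup.2 ⟨(a, c), ⟨ha, by simp⟩, (b, 0), ⟨hb, by simp⟩, by simp⟩
  bracket := LinearMap.mk₂ ℂ (fun x y => (S.bracket x.1 y.1, α x.1 y.1))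
    (by intros; simp) (by intros; simp) (by intros; simp) (by intros; simp)
  bracket_mem := by
    rintro p q ⟨x, c⟩ ⟨y, d⟩ ⟨hx, -⟩ ⟨hy, -⟩
    refine ⟨S.bracket_mem p q x y hx hy, ?_⟩
    change α x y ∈ _
    fin_cases p <;> fin_cases q
    · exact Submodule.mem_top
    · have h0 : α x y = 0 := heven x hx y hy
      rw [h0]; exact Submodule.zero_mem _
    · have h0 : α y x = 0 := heven y hy x hx
      have h1 : α x y = -(ksign 1 0 * α y x) := hα.1 1 0 x y hx hy
      rw [h1, h0]; simp
    · exact Submodule.mem_top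
  skew := by
    rintro p q ⟨x, c⟩ ⟨y, d⟩ ⟨hx, -⟩ ⟨hy, -⟩
    ext
    · simpa using S.skew p q x y hx hy
    · simpa using hα.1 p q x y hx hy
  jacobi := by
    rintro p q ⟨x, c⟩ ⟨y, d⟩ ⟨z, e⟩ ⟨hx, -⟩ ⟨hy, -⟩
    ext
    · simpa using S.jacobi p q x y z hx hy
    · simpa using hα.2 p q x y z hx hy

end General

end LieSuperalgebra

/-! ### The superalgebra `𝒜 = ℂ[t, t⁻¹] ⊗ Λ(1)` -/

/-- `ℂ[t, t⁻¹] ⊗ Λ(1)`, written as the ring of `f + g ξ` with `f, g ∈ ℂ[t, t⁻¹]` and `ξ² = 0`.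
With a single odd variable, the supercommutative product is commutative. -/
abbrev SLaurent : Type := DualNumber ℂ[T;T⁻¹]

namespace SLaurent

/-- The even part `{f}` and the odd part `{g ξ}`. -/
def par (p : ZMod 2) : Submodule ℂ SLaurent where
  carrier := {a | if p = 0 then a.snd = 0 else a.fst = 0}
  zero_mem' := by by_cases h : p = 0 <;> simp [h]
  add_mem' := by
    intro a b ha hb
    by_cases h : p = 0 <;> simp_all
  smul_mem' := by
    intro c a ha
    by_cases h : p = 0 <;> simp_all

/-- `t^n` -/
def t (n : ℤ) : SLaurent := TrivSqZeroExt.inl (LaurentPolynomial.T n)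

/-- `t^n ξ` -/
def tξ (n : ℤ) : SLaurent := TrivSqZeroExt.inr (LaurentPolynomial.T n)

/-- The Euler operator `t d/dt` on `ℂ[t, t⁻¹]`. -/
def euler : ℂ[T;T⁻¹] →ₗ[ℂ] ℂ[T;T⁻¹] :=
  (AddMonoidAlgebra.basis ℤ ℂ).constr ℂ (fun n => (n : ℂ) • LaurentPolynomial.T n)

/-- The even operator `t ∂/∂t`. -/
def tdt : SLaurent →ₗ[ℂ] SLaurent where
  toFun a := TrivSqZeroExt.inl (euler a.fst) + TrivSqZeroExt.inr (euler a.snd)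
  map_add' a b := by ext <;> simp
  map_smul' c a := by ext <;> simp

/-- The odd operator `∂/∂ξ`. -/
def dξ : SLaurent →ₗ[ℂ] SLaurent where
  toFun a := TrivSqZeroExt.inl a.snd
  map_add' a b := by ext <;> simp
  map_smul' c a := by ext <;> simp

/-- The superderivations of `𝒜` of parity `p`. -/
def superDer (p : ZMod 2) : Submodule ℂ (SLaurent →ₗ[ℂ] SLaurent) where
  carrier := {D |
    (∀ (q : ZMod 2) (a : SLaurent), a ∈ par q → D a ∈ par (p + q)) ∧
    ∀ (q : ZMod 2) (a b : SLaurent), a ∈ par q → D (a * b) = D a * b + ksign p q • (a * D b)}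
  zero_mem' := by
    refine ⟨fun q a _ => ?_, fun q a b _ => ?_⟩
    · exact Submodule.zero_mem _
    · simp
  add_mem' := by
    rintro D E ⟨h1, h2⟩ ⟨h3, h4⟩
    refine ⟨fun q a ha => Submodule.add_mem _ (h1 q a ha) (h3 q a ha), fun q a b ha => ?_⟩
    simp only [LinearMap.add_apply, h2 q a b ha, h4 q a b ha, add_mul, mul_add, smul_add]
    abel
  smul_mem' := by
    rintro c D ⟨h1, h2⟩
    refine ⟨fun q a ha => Submodule.smul_mem _ c (h1 q a ha), fun q a b ha => ?_⟩
    simp only [LinearMap.smul_apply, h2 q a b ha, smul_add, smul_mul_assoc, mul_smul_comm]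
    rw [smul_comm c]

/-- The supercommutator `D E - (-1)^(pq) E D` of operators of parities `p` and `q`. -/
def scomm (p q : ZMod 2) (D E : SLaurent →ₗ[ℂ] SLaurent) : SLaurent →ₗ[ℂ] SLaurent :=
  D ∘ₗ E - ksign p q • (E ∘ₗ D)

end SLaurent

theorem ksign_00 : ksign 0 0 = 1 := by simp [ksign]
theorem ksign_01 : ksign 0 1 = 1 := by simp [ksign]
theorem ksign_10 : ksign 1 0 = 1 := by simp [ksign]
theorem ksign_11 : ksign 1 1 = -1 := by simp [ksign]
theorem zmod2_cases (p : ZMod 2) : p = 0 ∨ p = 1 := by revert p; decide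
theorem zmod2_one_add_one : (1 : ZMod 2) + 1 = 0 := by decide

namespace SLaurent

theorem mem_par_zero {a : SLaurent} : a ∈ par 0 ↔ a.snd = 0 := Iff.rfl
theorem mem_par_one {a : SLaurent} : a ∈ par 1 ↔ a.fst = 0 := Iff.rfl

theorem mul_mem_par {p q : ZMod 2} {a b : SLaurent} (ha : a ∈ par p) (hb : b ∈ par q) :
    a * b ∈ par (p + q) := by
  rcases zmod2_cases p with rfl | rfl <;> rcases zmod2_cases q with rfl | rfl <;>
    simp only [zmod2_one_add_one, add_zero, zero_add, mem_par_zero, mem_par_one] at * <;>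
    simp [ha, hb]

theorem mul_comm_par {p q : ZMod 2} {a b : SLaurent} (ha : a ∈ par p) (hb : b ∈ par q) :
    a * b = ksign p q • (b * a) := by
  rcases zmod2_cases p with rfl | rfl <;> rcases zmod2_cases q with rfl | rfl <;>
    simp only [ksign_00, ksign_01, ksign_10, ksign_11, one_smul] <;> try exact mul_comm a b
  rw [mem_par_one] at ha hb
  ext <;> simp [ha, hb]

theorem scomm_mem {p q s : ZMod 2} (hs : p + q = s) {D E : SLaurent →ₗ[ℂ] SLaurent}
    (hD : D ∈ superDer p) (hE : E ∈ superDer q) : scomm p q D E ∈ superDer s := by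
  subst hs
  obtain ⟨hD1, hD2⟩ := hD
  obtain ⟨hE1, hE2⟩ := hE
  refine ⟨fun r a ha => ?_, fun r a b ha => ?_⟩
  · have h1 := hD1 _ _ (hE1 r a ha)
    have h2 := hE1 _ _ (hD1 r a ha)
    rw [show q + (p + r) = p + q + r by ring] at h2
    rw [show p + (q + r) = p + q + r by ring] at h1
    exact Submodule.sub_mem _ h1 (Submodule.smul_mem _ _ h2)
  · simp only [scomm, LinearMap.sub_apply, LinearMap.smul_apply, LinearMap.comp_apply,
      hE2 r a _ ha, hD2 r a _ ha, map_add, map_smul, hD2 _ _ _ (hE1 r a ha),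
      hE2 _ _ _ (hD1 r a ha)]
    rcases zmod2_cases p with rfl | rfl <;> rcases zmod2_cases q with rfl | rfl <;>
      rcases zmod2_cases r with rfl | rfl <;>
      simp only [zmod2_one_add_one, add_zero, zero_add, ksign_00, ksign_01, ksign_10, ksign_11,
        one_smul, neg_smul, sub_mul, mul_sub, neg_mul, mul_neg] <;> abel

theorem tdt_mem : tdt ∈ superDer 0 := by
  have hmul : ∀ f g : ℂ[T;T⁻¹], euler (f * g) = euler f * g + f * euler g := by
    intro f g
    have hT : ∀ n : ℤ, euler (LaurentPolynomial.T n) = (n : ℂ) • LaurentPolynomial.T n := by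
      intro n
      have h := (AddMonoidAlgebra.basis ℤ ℂ).constr_basis ℂ
        (fun n : ℤ => (n : ℂ) • (LaurentPolynomial.T n : ℂ[T;T⁻¹])) n
      exact h
    have key : ((LinearMap.mul ℂ ℂ[T;T⁻¹]).compr₂ euler) =
        (LinearMap.mul ℂ ℂ[T;T⁻¹]) ∘ₗ euler + (LinearMap.mul ℂ ℂ[T;T⁻¹]).compl₂ euler := by
      refine (AddMonoidAlgebra.basis ℤ ℂ).ext fun m => (AddMonoidAlgebra.basis ℤ ℂ).ext fun n => ?_
      have hb : ∀ k : ℤ, (AddMonoidAlgebra.basis ℤ ℂ) k = LaurentPolynomial.T k := fun k => rfl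
      simp only [LinearMap.compr₂_apply, LinearMap.mul_apply', LinearMap.add_apply,
        LinearMap.comp_apply, LinearMap.compl₂_apply, hb, ← LaurentPolynomial.T_add, hT,
        smul_mul_assoc, mul_smul_comm, Int.cast_add, add_smul]
    simpa using congrArg (fun F => F f g) key
  refine ⟨fun q a ha => ?_, fun q a b _ => ?_⟩
  · rcases zmod2_cases q with rfl | rfl <;>
      simp only [zero_add, mem_par_zero, mem_par_one] at * <;> simp [tdt, ha]
  · have hk : ksign 0 q = 1 := by simp [ksign]
    rw [hk, one_smul]
    ext
    · simp [tdt, hmul]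
    · simp [tdt, hmul]; ring

theorem dξ_mem : dξ ∈ superDer 1 := by
  refine ⟨fun q a ha => ?_, fun q a b ha => ?_⟩
  · rcases zmod2_cases q with rfl | rfl <;>
      simp only [zmod2_one_add_one, add_zero, mem_par_zero, mem_par_one] at * <;> simp [dξ, ha]
  · rcases zmod2_cases q with rfl | rfl <;>
      simp only [ksign_10, ksign_11, mem_par_zero, mem_par_one] at * <;>
      ext <;> simp [dξ, ha, mul_comm]

/-- Superderivations form a module over `𝒜`. -/
theorem mul_superDer_mem {p q s : ZMod 2} (hs : p + q = s) {c : SLaurent}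
    {D : SLaurent →ₗ[ℂ] SLaurent} (hc : c ∈ par p) (hD : D ∈ superDer q) :
    LinearMap.mulLeft ℂ c ∘ₗ D ∈ superDer s := by
  subst hs
  refine ⟨fun r a ha => ?_, fun r a b ha => ?_⟩
  · rw [add_assoc]
    exact mul_mem_par hc (hD.1 r a ha)
  · simp only [LinearMap.comp_apply, LinearMap.mulLeft_apply, hD.2 r a b ha, mul_add,
      mul_smul_comm]
    rw [mul_assoc, ← mul_assoc c a, mul_comm_par hc ha]
    rcases zmod2_cases p with rfl | rfl <;> rcases zmod2_cases q with rfl | rfl <;>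
      rcases zmod2_cases r with rfl | rfl <;>
      simp [zmod2_one_add_one, ksign_00, ksign_01, ksign_10, ksign_11, mul_assoc]

theorem t_mem (n : ℤ) : t n ∈ par 0 := by rw [mem_par_zero]; simp [t]
theorem tξ_mem (n : ℤ) : tξ n ∈ par 1 := by rw [mem_par_one]; simp [tξ]

end SLaurent

/-! ### The Witt superalgebra `𝒲` of superderivations of `𝒜` -/

open SLaurent

/-- The space of superderivations of `𝒜`: the direct sum of its even and its odd part. -/
def Witt : Type := superDer 0 × superDer 1

namespace Witt

instance : AddCommGroup Witt := inferInstanceAs (AddCommGroup (superDer 0 × superDer 1))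

instance : Module ℂ Witt := inferInstanceAs (Module ℂ (superDer 0 × superDer 1))

/-- The even component of a superderivation. -/
def even : Witt →ₗ[ℂ] (SLaurent →ₗ[ℂ] SLaurent) :=
  (superDer 0).subtype ∘ₗ LinearMap.fst ℂ (superDer 0) (superDer 1)

/-- The odd component of a superderivation. -/
def odd : Witt →ₗ[ℂ] (SLaurent →ₗ[ℂ] SLaurent) :=
  (superDer 1).subtype ∘ₗ LinearMap.snd ℂ (superDer 0) (superDer 1)

/-- The superderivation with even component `D` and odd component `E`. -/
def mk (D E : SLaurent →ₗ[ℂ] SLaurent) (hD : D ∈ superDer 0) (hE : E ∈ superDer 1) : Witt :=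
  ((⟨D, hD⟩, ⟨E, hE⟩) : superDer 0 × superDer 1)

@[simp] theorem even_mk {D E : SLaurent →ₗ[ℂ] SLaurent} (hD : D ∈ superDer 0)
    (hE : E ∈ superDer 1) : even (mk D E hD hE) = D := rfl

@[simp] theorem odd_mk {D E : SLaurent →ₗ[ℂ] SLaurent} (hD : D ∈ superDer 0)
    (hE : E ∈ superDer 1) : odd (mk D E hD hE) = E := rfl

theorem even_mem (X : Witt) : even X ∈ superDer 0 := X.1.2

theorem odd_mem (X : Witt) : odd X ∈ superDer 1 := X.2.2

theorem ext {X Y : Witt} (h0 : even X = even Y) (h1 : odd X = odd Y) : X = Y :=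
  Prod.ext (Subtype.ext h0) (Subtype.ext h1)

/-- The parity `p` part of `𝒲`. -/
def par (p : ZMod 2) : Submodule ℂ Witt := if p = 0 then LinearMap.ker odd else LinearMap.ker even

/-- The bracket of `𝒲`: the supercommutator, extended bilinearly. -/
def bracket : Witt →ₗ[ℂ] Witt →ₗ[ℂ] Witt :=
  LinearMap.mk₂ ℂ
    (fun X Y => mk
      (scomm 0 0 (even X) (even Y) + scomm 1 1 (odd X) (odd Y))
      (scomm 0 1 (even X) (odd Y) + scomm 1 0 (odd X) (even Y))
      (Submodule.add_mem _ (scomm_mem (add_zero 0) X.even_mem Y.even_mem)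
        (scomm_mem zmod2_one_add_one X.odd_mem Y.odd_mem))
      (Submodule.add_mem _ (scomm_mem (zero_add 1) X.even_mem Y.odd_mem)
        (scomm_mem (add_zero 1) X.odd_mem Y.even_mem)))
    (by
      intros
      apply ext <;> simp [scomm, LinearMap.add_comp, LinearMap.comp_add, smul_add] <;> abel)
    (by
      intros
      apply ext <;> simp [scomm, LinearMap.smul_comp, LinearMap.comp_smul, smul_sub, smul_add] <;>
        simp only [smul_comm _ (ksign _ _)])
    (by
      intros
      apply ext <;> simp [scomm, LinearMap.add_comp, LinearMap.comp_add, smul_add] <;> abel)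
    (by
      intros
      apply ext <;> simp [scomm, LinearMap.smul_comp, LinearMap.comp_smul, smul_sub, smul_add] <;>
        simp only [smul_comm _ (ksign _ _)])

/-- `d_i = t^(i+1) ∂/∂t` -/
def d (i : ℤ) : Witt :=
  mk (LinearMap.mulLeft ℂ (t i) ∘ₗ tdt) 0 (mul_superDer_mem (add_zero 0) (t_mem i) tdt_mem)
    (Submodule.zero_mem _)

/-- `h_i = t^i ξ ∂/∂ξ` -/
def h (i : ℤ) : Witt :=
  mk (LinearMap.mulLeft ℂ (tξ i) ∘ₗ dξ) 0
    (mul_superDer_mem zmod2_one_add_one (tξ_mem i) dξ_mem) (Submodule.zero_mem _)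

/-- `Q_i = t^i ∂/∂ξ` -/
def Q (i : ℤ) : Witt :=
  mk 0 (LinearMap.mulLeft ℂ (t i) ∘ₗ dξ) (Submodule.zero_mem _)
    (mul_superDer_mem (zero_add 1) (t_mem i) dξ_mem)

/-- `G_i = t^(i+1) ξ ∂/∂t` -/
def G (i : ℤ) : Witt :=
  mk 0 (LinearMap.mulLeft ℂ (tξ i) ∘ₗ tdt) (Submodule.zero_mem _)
    (mul_superDer_mem (add_zero 1) (tξ_mem i) tdt_mem)

end Witt

/-! ### The Lie superalgebra `ℒ = 𝒲 ⋉ (𝔤 ⊗ 𝒜)` -/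

namespace SLaurent

/-- The projection of `𝒜` to its even part. -/
def evenPart : SLaurent →ₗ[ℂ] SLaurent where
  toFun a := TrivSqZeroExt.inl a.fst
  map_add' a b := by ext <;> simp
  map_smul' c a := by ext <;> simp

/-- The projection of `𝒜` to its odd part. -/
def oddPart : SLaurent →ₗ[ℂ] SLaurent where
  toFun a := TrivSqZeroExt.inr a.snd
  map_add' a b := by ext <;> simp
  map_smul' c a := by ext <;> simp

theorem evenPart_add_oddPart (a : SLaurent) : evenPart a + oddPart a = a := by
  ext <;> simp [evenPart, oddPart]

theorem evenPart_mem (a : SLaurent) : evenPart a ∈ par 0 := by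
  rw [mem_par_zero]; simp [evenPart]

theorem oddPart_mem (a : SLaurent) : oddPart a ∈ par 1 := by
  rw [mem_par_one]; simp [oddPart]

theorem evenPart_of_mem {p : ZMod 2} {a : SLaurent} (ha : a ∈ par p) :
    evenPart a = if p = 0 then a else 0 := by
  rcases zmod2_cases p with rfl | rfl <;> simp only [mem_par_zero, mem_par_one] at ha <;>
    ext <;> simp [evenPart, ha]

theorem oddPart_of_mem {p : ZMod 2} {a : SLaurent} (ha : a ∈ par p) :
    oddPart a = if p = 0 then 0 else a := by
  rcases zmod2_cases p with rfl | rfl <;> simp only [mem_par_zero, mem_par_one] at ha <;>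
    ext <;> simp [oddPart, ha]

end SLaurent

namespace LieSuperalgebra

section Loop

variable {g : Type u} [AddCommGroup g] [Module ℂ g] (S : LieSuperalgebra g)

theorem parityMap_of_mem {p : ZMod 2} {x : g} (hx : x ∈ S.par p) :
    S.parityMap x = ksign 1 p • x := by
  rcases zmod2_cases p with rfl | rfl
  · simp [parityMap, ksign_10, Submodule.projection_apply_of_mem_left S.isCompl hx,
      (Submodule.projection_apply_eq_zero_iff S.isCompl.symm).2 hx]
  · simp [parityMap, ksign_11, Submodule.projection_apply_of_mem_left S.isCompl.symm hx,
      (Submodule.projection_apply_eq_zero_iff S.isCompl).2 hx]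

/-- The parity `p` part of `𝔤 ⊗ 𝒜`. -/
def loopPar (p : ZMod 2) : Submodule ℂ (g ⊗[ℂ] SLaurent) :=
  Submodule.span ℂ {u | ∃ (i j : ZMod 2) (x : g) (a : SLaurent),
    i + j = p ∧ x ∈ S.par i ∧ a ∈ SLaurent.par j ∧ x ⊗ₜ[ℂ] a = u}

/-- The bracket `[x ⊗ a, y ⊗ b] = (-1)^(|a||y|) [x, y] ⊗ ab` of `𝔤 ⊗ 𝒜`. -/
def loopBracket : (g ⊗[ℂ] SLaurent) →ₗ[ℂ] (g ⊗[ℂ] SLaurent) →ₗ[ℂ] (g ⊗[ℂ] SLaurent) :=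
  TensorProduct.map₂ S.bracket (LinearMap.mul ℂ SLaurent ∘ₗ evenPart) +
    TensorProduct.map₂ (S.bracket.compl₂ S.parityMap) (LinearMap.mul ℂ SLaurent ∘ₗ oddPart)

/-- The action `D · (x ⊗ a) = x ⊗ D(a)` of the even component of a superderivation. -/
def evenAction : Witt →ₗ[ℂ] (g ⊗[ℂ] SLaurent) →ₗ[ℂ] (g ⊗[ℂ] SLaurent) :=
  TensorProduct.mapBilinear (RingHom.id ℂ) g SLaurent g SLaurent LinearMap.id ∘ₗ Witt.even

/-- The action `D · (x ⊗ a) = (-1)^|x| x ⊗ D(a)` of the odd component of a superderivation. -/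
def oddAction : Witt →ₗ[ℂ] (g ⊗[ℂ] SLaurent) →ₗ[ℂ] (g ⊗[ℂ] SLaurent) :=
  TensorProduct.mapBilinear (RingHom.id ℂ) g SLaurent g SLaurent S.parityMap ∘ₗ Witt.odd

/-- The parity involution of `𝔤 ⊗ 𝒜`. -/
def loopParity : (g ⊗[ℂ] SLaurent) →ₗ[ℂ] (g ⊗[ℂ] SLaurent) :=
  TensorProduct.map S.parityMap (evenPart - oddPart)

theorem loopBracket_tmul {i j : ZMod 2} {x y : g} {a b : SLaurent} (hy : y ∈ S.par i)
    (ha : a ∈ SLaurent.par j) :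
    S.loopBracket (x ⊗ₜ a) (y ⊗ₜ b) = ksign j i • (S.bracket x y ⊗ₜ (a * b)) := by
  rcases zmod2_cases j with rfl | rfl <;>
    rcases zmod2_cases i with rfl | rfl <;>
    simp [loopBracket, evenPart_of_mem ha, oddPart_of_mem ha, S.parityMap_of_mem hy, ksign,
      TensorProduct.neg_tmul]

theorem loopParity_of_mem {p : ZMod 2} {u : g ⊗[ℂ] SLaurent} (hu : u ∈ S.loopPar p) :
    S.loopParity u = ksign 1 p • u := by
  induction hu using Submodule.span_induction with
  | mem u hu =>
    obtain ⟨i, j, x, a, rfl, hx, ha, rfl⟩ := hu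
    rcases zmod2_cases i with rfl | rfl <;> rcases zmod2_cases j with rfl | rfl <;>
    simp [loopParity, evenPart_of_mem ha, oddPart_of_mem ha, S.parityMap_of_mem hx, ksign_10,
      ksign_11, TensorProduct.neg_tmul, TensorProduct.tmul_neg, zmod2_one_add_one]
  | zero => simp
  | add u v _ _ hu hv => simp [hu, hv]
  | smul c u _ hu => rw [map_smul, hu, smul_comm]

end Loop

end LieSuperalgebra

/-- The underlying space of `𝒲 ⋉ (𝔤 ⊗ 𝒜)`. -/
abbrev AffineWitt (g : Type u) [AddCommGroup g] [Module ℂ g] : Type u :=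
  Witt × (g ⊗[ℂ] SLaurent)

namespace LieSuperalgebra

section Semidirect

variable {g : Type u} [AddCommGroup g] [Module ℂ g] (S : LieSuperalgebra g)

/-- The parity `p` part of `𝒲 ⋉ (𝔤 ⊗ 𝒜)`. -/
def affineWittPar (p : ZMod 2) : Submodule ℂ (AffineWitt g) := (Witt.par p).prod (S.loopPar p)

/-- The bracket of the semidirect product: `[(X, u), (Y, v)] = ([X, Y], X · v + [u, Y] + [u, v])`
with `[u, Y] = -(-1)^(|u||Y|) Y · u`. -/
def affineWittBracket : AffineWitt g →ₗ[ℂ] AffineWitt g →ₗ[ℂ] AffineWitt g :=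
  LinearMap.mk₂ ℂ
    (fun X Y => (Witt.bracket X.1 Y.1,
      (evenAction X.1 Y.2 + S.oddAction X.1 Y.2)
        - (evenAction Y.1 X.2 + S.oddAction Y.1 (S.loopParity X.2))
        + S.loopBracket X.2 Y.2))
    (by
      intros
      ext1
      · simp
      · simp; abel)
    (by
      intros
      ext1
      · simp
      · simp [smul_sub])
    (by
      intros
      ext1
      · simp
      · simp; abel)
    (by
      intros
      ext1
      · simp
      · simp [smul_sub])

/-- The superderivation `D` of parity `p`, as an element of `𝒲`. -/
def ofDer (p : ZMod 2) (D : SLaurent →ₗ[ℂ] SLaurent) (hD : D ∈ superDer p) : Witt :=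
  if hp : p = 0 then Witt.mk D 0 (hp ▸ hD) (Submodule.zero_mem _)
  else Witt.mk 0 D (Submodule.zero_mem _) ((zmod2_cases p).resolve_left hp ▸ hD)

theorem ofDer_zero (D : SLaurent →ₗ[ℂ] SLaurent) (hD : D ∈ superDer 0) :
    ofDer 0 D hD = Witt.mk D 0 hD (Submodule.zero_mem _) := rfl

theorem ofDer_one (D : SLaurent →ₗ[ℂ] SLaurent) (hD : D ∈ superDer 1) :
    ofDer 1 D hD = Witt.mk 0 D (Submodule.zero_mem _) hD := rfl

theorem even_ofDer (p : ZMod 2) (D : SLaurent →ₗ[ℂ] SLaurent) (hD : D ∈ superDer p) :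
    Witt.even (ofDer p D hD) = if p = 0 then D else 0 := by
  rcases zmod2_cases p with rfl | rfl
  · simp [ofDer_zero]
  · simp [ofDer_one]

theorem odd_ofDer (p : ZMod 2) (D : SLaurent →ₗ[ℂ] SLaurent) (hD : D ∈ superDer p) :
    Witt.odd (ofDer p D hD) = if p = 0 then 0 else D := by
  rcases zmod2_cases p with rfl | rfl
  · simp [ofDer_zero]
  · simp [ofDer_one]

theorem ofDer_bracket {p q : ZMod 2} {D E : SLaurent →ₗ[ℂ] SLaurent} (hD : D ∈ superDer p)
    (hE : E ∈ superDer q) :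
    Witt.bracket (ofDer p D hD) (ofDer q E hE) =
      ofDer (p + q) (scomm p q D E) (scomm_mem rfl hD hE) := by
  apply Witt.ext <;> rcases zmod2_cases p with rfl | rfl <;>
    rcases zmod2_cases q with rfl | rfl <;>
    simp [Witt.bracket, even_ofDer, odd_ofDer, scomm, zmod2_one_add_one]

theorem action_tmul {p i : ZMod 2} {D : SLaurent →ₗ[ℂ] SLaurent} (hD : D ∈ superDer p)
    {x : g} (hx : x ∈ S.par i) (a : SLaurent) :
    evenAction (ofDer p D hD) (x ⊗ₜ a) + S.oddAction (ofDer p D hD) (x ⊗ₜ a) =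
      ksign p i • (x ⊗ₜ D a) := by
  rcases zmod2_cases p with rfl | rfl
  · simp [evenAction, oddAction, even_ofDer, odd_ofDer, ksign]
  · simp [evenAction, oddAction, even_ofDer, odd_ofDer, S.parityMap_of_mem hx,
      TensorProduct.smul_tmul']

theorem ofDer_mem {p : ZMod 2} {D : SLaurent →ₗ[ℂ] SLaurent} (hD : D ∈ superDer p) :
    ((ofDer p D hD, 0) : AffineWitt g) ∈ S.affineWittPar p := by
  rcases zmod2_cases p with rfl | rfl <;>
    simp [affineWittPar, Witt.par, even_ofDer, odd_ofDer]

/-- Homogeneous generators of `𝒲 ⋉ (𝔤 ⊗ 𝒜)`. -/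
inductive Gen : ZMod 2 → AffineWitt g → Prop
  | der (p : ZMod 2) (D : SLaurent →ₗ[ℂ] SLaurent) (hD : D ∈ superDer p) : Gen p (ofDer p D hD, 0)
  | cur (p i j : ZMod 2) (x : g) (a : SLaurent) (hp : i + j = p) (hx : x ∈ S.par i)
      (ha : a ∈ SLaurent.par j) : Gen p (0, x ⊗ₜ a)

theorem span_gen (p : ZMod 2) : Submodule.span ℂ {X | S.Gen p X} = S.affineWittPar p := by
  apply le_antisymm
  · rw [Submodule.span_le]
    rintro X hX
    cases hX with
    | der D hD => exact S.ofDer_mem hD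
    | cur i j x a hp hx ha =>
      refine ⟨Submodule.zero_mem _, Submodule.subset_span ⟨i, j, x, a, hp, hx, ha, rfl⟩⟩
  · rintro ⟨X, u⟩ ⟨hX, hu⟩
    have h1 : ((X, 0) : AffineWitt g) ∈ Submodule.span ℂ {X | S.Gen p X} := by
      apply Submodule.subset_span
      rcases zmod2_cases p with rfl | rfl
      · have h : X = ofDer 0 (Witt.even X) X.even_mem :=
          Witt.ext (by simp [even_ofDer]) (by simpa [odd_ofDer, Witt.par] using hX)
        rw [h]
        exact Gen.der 0 (Witt.even X) X.even_mem
      · have h : X = ofDer 1 (Witt.odd X) X.odd_mem :=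
          Witt.ext (by simpa [even_ofDer, Witt.par] using hX) (by simp [odd_ofDer])
        rw [h]
        exact Gen.der 1 (Witt.odd X) X.odd_mem
    have h2 : ((0, u) : AffineWitt g) ∈ Submodule.span ℂ {X | S.Gen p X} := by
      change u ∈ S.loopPar p at hu
      clear h1 hX
      induction hu using Submodule.span_induction with
      | mem u hu =>
        obtain ⟨i, j, x, a, hp, hx, ha, rfl⟩ := hu
        exact Submodule.subset_span (Gen.cur p i j x a hp hx ha)
      | zero => exact Submodule.zero_mem _
      | add u v _ _ hu hv => simpa using Submodule.add_mem _ hu hv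
      | smul c u _ hu => simpa using Submodule.smul_mem _ c hu
    simpa using Submodule.add_mem _ h1 h2

theorem affineWitt_isCompl : IsCompl (S.affineWittPar 0) (S.affineWittPar 1) := by
  constructor
  · rw [Submodule.disjoint_def]
    rintro ⟨X, u⟩ ⟨hX, hu⟩ ⟨hX2, hu2⟩
    have h1 : X = 0 :=
      Witt.ext (by simpa [Witt.par] using hX2) (by simpa [Witt.par] using hX)
    have h2 := S.loopParity_of_mem hu
    rw [S.loopParity_of_mem hu2, ksign_10, ksign_11, one_smul, neg_one_smul] at h2
    have h3 : (2 : ℂ) • u = 0 := by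
      rw [two_smul]; nth_rewrite 1 [← show -u = u from h2]; exact neg_add_cancel u
    replace h3 : u = 0 := (smul_eq_zero.1 h3).resolve_left two_ne_zero
    rw [h1, h3]; rfl
  · rw [codisjoint_iff, eq_top_iff]
    rintro ⟨X, u⟩ -
    have h1 : ((X, 0) : AffineWitt g) ∈ S.affineWittPar 0 ⊔ S.affineWittPar 1 :=
      Submodule.mem_sup.2 ⟨_, S.ofDer_mem X.even_mem, _, S.ofDer_mem X.odd_mem, by
        ext1
        · apply Witt.ext <;> simp [even_ofDer, odd_ofDer]
        · simp⟩
    have h2 : ((0, u) : AffineWitt g) ∈ S.affineWittPar 0 ⊔ S.affineWittPar 1 := by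
      induction u using TensorProduct.induction_on with
      | zero => exact Submodule.zero_mem _
      | add u v hu hv => simpa using Submodule.add_mem _ hu hv
      | tmul x a =>
        obtain ⟨y, hy, z, hz, rfl⟩ := Submodule.mem_sup.1
          (S.isCompl.sup_eq_top ▸ Submodule.mem_top : x ∈ S.par 0 ⊔ S.par 1)
        have key : ∀ (i j : ZMod 2) (x : g) (a : SLaurent), x ∈ S.par i → a ∈ SLaurent.par j →
            ((0, x ⊗ₜ a) : AffineWitt g) ∈ S.affineWittPar 0 ⊔ S.affineWittPar 1 := by
          intro i j x a hx ha
          have h : ((0, x ⊗ₜ a) : AffineWitt g) ∈ S.affineWittPar (i + j) := by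
            rw [← span_gen]
            exact Submodule.subset_span (Gen.cur _ i j x a rfl hx ha)
          rcases zmod2_cases (i + j) with hij | hij <;> rw [hij] at h
          · exact Submodule.mem_sup_left h
          · exact Submodule.mem_sup_right h
        have e : ((0, (y + z) ⊗ₜ a) : AffineWitt g) =
            ((0, y ⊗ₜ evenPart a) + (0, y ⊗ₜ oddPart a)) +
              ((0, z ⊗ₜ evenPart a) + (0, z ⊗ₜ oddPart a)) := by
          simp [← TensorProduct.tmul_add, evenPart_add_oddPart, TensorProduct.add_tmul]
        rw [e]
        exact Submodule.add_mem _
          (Submodule.add_mem _ (key _ _ _ _ hy (evenPart_mem a)) (key _ _ _ _ hy (oddPart_mem a)))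
          (Submodule.add_mem _ (key _ _ _ _ hz (evenPart_mem a)) (key _ _ _ _ hz (oddPart_mem a)))
    simpa using Submodule.add_mem _ h1 h2

theorem affineWittBracket_der_der {p q : ZMod 2} {D E : SLaurent →ₗ[ℂ] SLaurent}
    (hD : D ∈ superDer p) (hE : E ∈ superDer q) :
    S.affineWittBracket (ofDer p D hD, 0) (ofDer q E hE, 0) =
      (ofDer (p + q) (scomm p q D E) (scomm_mem rfl hD hE), 0) := by
  rw [← ofDer_bracket hD hE]
  simp [affineWittBracket]

theorem affineWittBracket_der_cur {p i : ZMod 2} {D : SLaurent →ₗ[ℂ] SLaurent}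
    (hD : D ∈ superDer p) {x : g} (hx : x ∈ S.par i) (a : SLaurent) :
    S.affineWittBracket (ofDer p D hD, 0) (0, x ⊗ₜ a) = ksign p i • (0, x ⊗ₜ D a) := by
  have h := S.action_tmul hD hx a
  ext1
  · simp [affineWittBracket]
  · simp [affineWittBracket, h]

theorem affineWittBracket_cur_der {p i j : ZMod 2} {D : SLaurent →ₗ[ℂ] SLaurent}
    (hD : D ∈ superDer p) {x : g} (hx : x ∈ S.par i) {a : SLaurent} (ha : a ∈ SLaurent.par j) :
    S.affineWittBracket (0, x ⊗ₜ a) (ofDer p D hD, 0) = -(ksign p j • (0, x ⊗ₜ D a)) := by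
  have h2 := S.loopParity_of_mem (Submodule.subset_span ⟨i, j, x, a, rfl, hx, ha, rfl⟩)
  ext1
  · simp [affineWittBracket]
  · simp only [affineWittBracket, LinearMap.mk₂_apply, h2, map_smul, map_zero,
      LinearMap.zero_apply, zero_add, add_zero, zero_sub, evenAction, oddAction,
      LinearMap.comp_apply, TensorProduct.mapBilinear_apply, even_ofDer, odd_ofDer]
    rcases zmod2_cases p with rfl | rfl <;> rcases zmod2_cases i with rfl | rfl <;>
      rcases zmod2_cases j with rfl | rfl <;>
      simp [ksign_00, ksign_01, ksign_10, ksign_11, zmod2_one_add_one, S.parityMap_of_mem hx,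
        TensorProduct.neg_tmul]

theorem affineWittBracket_cur_cur {i j : ZMod 2} (x : g) {y : g} (hy : y ∈ S.par i)
    {a : SLaurent} (ha : a ∈ SLaurent.par j) (b : SLaurent) :
    S.affineWittBracket (0, x ⊗ₜ a) (0, y ⊗ₜ b) = ksign j i • (0, S.bracket x y ⊗ₜ (a * b)) := by
  have h := S.loopBracket_tmul (x := x) (b := b) hy ha
  ext1
  · simp [affineWittBracket]
  · simp [affineWittBracket, h]

end Semidirect

end LieSuperalgebra

namespace LieSuperalgebra

section Main

variable {g : Type u} [AddCommGroup g] [Module ℂ g] (S : LieSuperalgebra g)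

theorem ksign_add_left (p q r : ZMod 2) : ksign (p + q) r = ksign p r * ksign q r := by
  rcases zmod2_cases p with rfl | rfl <;> rcases zmod2_cases q with rfl | rfl <;>
    rcases zmod2_cases r with rfl | rfl <;>
    simp [zmod2_one_add_one, ksign_00, ksign_01, ksign_10, ksign_11]

theorem ksign_comm (p q : ZMod 2) : ksign p q = ksign q p := by
  rcases zmod2_cases p with rfl | rfl <;> rcases zmod2_cases q with rfl | rfl <;> simp [ksign]

theorem ksign_mul_self (p q : ZMod 2) : ksign p q * ksign p q = 1 := by
  rcases zmod2_cases p with rfl | rfl <;> rcases zmod2_cases q with rfl | rfl <;> simp [ksign]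

theorem bracket_mem_gen {p q : ZMod 2} {X Y : AffineWitt g} (hX : S.Gen p X) (hY : S.Gen q Y) :
    S.affineWittBracket X Y ∈ S.affineWittPar (p + q) := by
  have hcur : ∀ (i j r : ZMod 2) (x : g) (a : SLaurent), i + j = r → x ∈ S.par i →
      a ∈ SLaurent.par j → ((0, x ⊗ₜ a) : AffineWitt g) ∈ S.affineWittPar r := by
    intro i j r x a hr hx ha
    rw [← span_gen]
    exact Submodule.subset_span (Gen.cur r i j x a hr hx ha)
  cases hX with
  | der D hD =>
    cases hY with
    | der E hE => rw [affineWittBracket_der_der]; exact S.ofDer_mem _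
    | cur i j y b hq hy hb =>
      rw [affineWittBracket_der_cur S hD hy]
      refine Submodule.smul_mem _ _ (hcur i (p + j) _ _ _ ?_ hy (hD.1 j b hb))
      rw [← hq]; ring
  | cur i j x a hp hx ha =>
    cases hY with
    | der E hE =>
      rw [affineWittBracket_cur_der S hE hx ha]
      have h := hcur i (q + j) (p + q) x (E a) (by rw [← hp]; ring) hx (hE.1 j a ha)
      exact Submodule.neg_mem _ (Submodule.smul_mem _ _ h)
    | cur k l y b hq hy hb =>
      rw [affineWittBracket_cur_cur S x hy ha]
      refine Submodule.smul_mem _ _ (hcur (i + k) (j + l) _ _ _ ?_ (S.bracket_mem i k x y hx hy)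
        (SLaurent.mul_mem_par ha hb))
      rw [← hp, ← hq]; ring

theorem ofDer_congr {p q : ZMod 2} {D E : SLaurent →ₗ[ℂ] SLaurent} (hpq : p = q) (hDE : D = E)
    (hD : D ∈ superDer p) (hE : E ∈ superDer q) : ofDer p D hD = ofDer q E hE := by
  subst hpq hDE; rfl

theorem ofDer_add {p : ZMod 2} {D E : SLaurent →ₗ[ℂ] SLaurent} (hD : D ∈ superDer p)
    (hE : E ∈ superDer p) :
    ofDer p (D + E) (Submodule.add_mem _ hD hE) = ofDer p D hD + ofDer p E hE := by
  apply Witt.ext <;> rcases zmod2_cases p with rfl | rfl <;> simp [even_ofDer, odd_ofDer]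

theorem ofDer_smul {p : ZMod 2} {D : SLaurent →ₗ[ℂ] SLaurent} (c : ℂ) (hD : D ∈ superDer p) :
    ofDer p (c • D) (Submodule.smul_mem _ c hD) = c • ofDer p D hD := by
  apply Witt.ext <;> rcases zmod2_cases p with rfl | rfl <;> simp [even_ofDer, odd_ofDer]

theorem scomm_skew (p q : ZMod 2) (D E : SLaurent →ₗ[ℂ] SLaurent) :
    scomm p q D E = (-ksign p q) • scomm q p E D := by
  rw [scomm, scomm, ksign_comm q p, smul_sub, smul_smul, neg_mul, ksign_mul_self, neg_smul,
    neg_one_smul]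
  abel

theorem scomm_jacobi (p q r : ZMod 2) (D E F : SLaurent →ₗ[ℂ] SLaurent) :
    scomm p (q + r) D (scomm q r E F) = scomm (p + q) r (scomm p q D E) F +
      ksign p q • scomm q (p + r) E (scomm p r D F) := by
  ext1 a
  simp only [scomm, LinearMap.sub_apply, LinearMap.add_apply, LinearMap.smul_apply,
    LinearMap.comp_apply, map_sub, map_smul]
  rcases zmod2_cases p with rfl | rfl <;> rcases zmod2_cases q with rfl | rfl <;>
    rcases zmod2_cases r with rfl | rfl <;>
    simp only [zmod2_one_add_one, add_zero, zero_add, ksign_00, ksign_01, ksign_10, ksign_11,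
      one_smul, neg_smul] <;> abel

theorem skew_gen {p q : ZMod 2} {X Y : AffineWitt g} (hX : S.Gen p X) (hY : S.Gen q Y) :
    S.affineWittBracket X Y = -(ksign p q • S.affineWittBracket Y X) := by
  cases hX with
  | der D hD =>
    cases hY with
    | der E hE =>
      have h : ofDer (p + q) (scomm p q D E) (scomm_mem rfl hD hE) =
          (-ksign p q) • ofDer (q + p) (scomm q p E D) (scomm_mem rfl hE hD) := by
        rw [← ofDer_smul]
        exact ofDer_congr (add_comm p q) (scomm_skew p q D E) _ _
      rw [affineWittBracket_der_der, affineWittBracket_der_der, h]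
      ext1
      · simp
      · simp
    | cur i j y b hq hy hb =>
      rw [affineWittBracket_der_cur S hD hy, affineWittBracket_cur_der S hD hy hb, ← hq]
      rcases zmod2_cases i with rfl | rfl <;> rcases zmod2_cases j with rfl | rfl <;>
        rcases zmod2_cases p with rfl | rfl <;>
        simp [zmod2_one_add_one, ksign_00, ksign_01, ksign_10, ksign_11]
  | cur i j x a hp hx ha =>
    cases hY with
    | der E hE =>
      rw [affineWittBracket_der_cur S hE hx, affineWittBracket_cur_der S hE hx ha, ← hp]
      rcases zmod2_cases i with rfl | rfl <;> rcases zmod2_cases j with rfl | rfl <;>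
        rcases zmod2_cases q with rfl | rfl <;>
        simp [zmod2_one_add_one, ksign_00, ksign_01, ksign_10, ksign_11]
    | cur k l y b hq hy hb =>
      rw [affineWittBracket_cur_cur S x hy ha, affineWittBracket_cur_cur S y hx hb,
        S.skew i k x y hx hy, SLaurent.mul_comm_par ha hb, ← hp, ← hq]
      rcases zmod2_cases i with rfl | rfl <;> rcases zmod2_cases j with rfl | rfl <;>
        rcases zmod2_cases k with rfl | rfl <;> rcases zmod2_cases l with rfl | rfl <;>
        simp [zmod2_one_add_one, ksign_00, ksign_01, ksign_10, ksign_11, TensorProduct.neg_tmul,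
          TensorProduct.tmul_neg]

theorem jacobi_gen {p q r : ZMod 2} {X Y Z : AffineWitt g} (hX : S.Gen p X) (hY : S.Gen q Y)
    (hZ : S.Gen r Z) :
    S.affineWittBracket X (S.affineWittBracket Y Z) =
      S.affineWittBracket (S.affineWittBracket X Y) Z +
        ksign p q • S.affineWittBracket Y (S.affineWittBracket X Z) := by
  cases hX with
  | der D hD =>
    cases hY with
    | der E hE =>
      cases hZ with
      | der F hF =>
        simp only [affineWittBracket_der_der]
        refine Prod.ext ?_ (by simp)
        simp only [Prod.fst_add, Prod.smul_fst]
        rw [← ofDer_smul]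
        have h : ofDer (q + (p + r)) (ksign p q • scomm q (p + r) E (scomm p r D F))
            (Submodule.smul_mem _ _ (scomm_mem rfl hE (scomm_mem rfl hD hF))) =
            ofDer (p + q + r) (ksign p q • scomm q (p + r) E (scomm p r D F))
            (Submodule.smul_mem _ _ (scomm_mem (by ring) hE (scomm_mem rfl hD hF))) :=
          ofDer_congr (by ring) rfl _ _
        rw [h, ← ofDer_add]
        exact ofDer_congr (by ring) (scomm_jacobi p q r D E F) _ _
      | cur k l z c hr hz hc =>
        rw [affineWittBracket_der_cur S hE hz, affineWittBracket_der_der, map_smul,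
          affineWittBracket_der_cur S hD hz, affineWittBracket_der_cur S _ hz,
          affineWittBracket_der_cur S hD hz, map_smul, affineWittBracket_der_cur S hE hz]
        refine Prod.ext (by simp) ?_
        simp only [Prod.snd_add, Prod.smul_snd, Prod.snd_neg, scomm, LinearMap.sub_apply,
          LinearMap.smul_apply, LinearMap.comp_apply, TensorProduct.tmul_add, TensorProduct.tmul_sub,
          TensorProduct.add_tmul, TensorProduct.neg_tmul, TensorProduct.tmul_smul,
          ← TensorProduct.smul_tmul']
        rcases zmod2_cases p with rfl | rfl <;>
          rcases zmod2_cases q with rfl | rfl <;>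
          rcases zmod2_cases k with rfl | rfl <;>
          simp only [zmod2_one_add_one, add_zero, zero_add, ksign_00, ksign_01, ksign_10, ksign_11,
            one_smul, neg_smul, smul_neg, smul_add, smul_sub, neg_neg] <;> abel
    | cur i j x a hq hx ha =>
      cases hZ with
      | der F hF =>
        rw [affineWittBracket_cur_der S hF hx ha, affineWittBracket_der_cur S hD hx,
          affineWittBracket_der_der, map_neg, map_smul, affineWittBracket_der_cur S hD hx, map_smul,
          LinearMap.smul_apply, affineWittBracket_cur_der S hF hx (hD.1 j a ha),
          affineWittBracket_cur_der S (scomm_mem rfl hD hF) hx ha, ← hq]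
        refine Prod.ext (by simp) ?_
        simp only [Prod.snd_add, Prod.smul_snd, Prod.snd_neg, scomm, LinearMap.sub_apply,
          LinearMap.smul_apply, LinearMap.comp_apply, TensorProduct.tmul_add, TensorProduct.tmul_sub,
          TensorProduct.add_tmul, TensorProduct.neg_tmul, TensorProduct.tmul_smul,
          ← TensorProduct.smul_tmul']
        rcases zmod2_cases p with rfl | rfl <;>
          rcases zmod2_cases i with rfl | rfl <;>
          rcases zmod2_cases j with rfl | rfl <;>
          rcases zmod2_cases r with rfl | rfl <;>
          simp only [zmod2_one_add_one, add_zero, zero_add, ksign_00, ksign_01, ksign_10, ksign_11,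
            one_smul, neg_smul, smul_neg, smul_add, smul_sub, neg_neg] <;> abel
      | cur k l y b hr hy hb =>
        rw [affineWittBracket_cur_cur S x hy ha, affineWittBracket_der_cur S hD hx,
          affineWittBracket_der_cur S hD hy, map_smul, affineWittBracket_der_cur S hD
          (S.bracket_mem i k x y hx hy), map_smul, LinearMap.smul_apply,
          affineWittBracket_cur_cur S x hy (hD.1 j a ha), map_smul,
          affineWittBracket_cur_cur S x hy ha, ← hq, hD.2 j a b ha]
        refine Prod.ext (by simp) ?_
        simp only [Prod.snd_add, Prod.smul_snd, Prod.snd_neg, scomm, LinearMap.sub_apply,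
          LinearMap.smul_apply, LinearMap.comp_apply, TensorProduct.tmul_add, TensorProduct.tmul_sub,
          TensorProduct.add_tmul, TensorProduct.neg_tmul, TensorProduct.tmul_smul,
          ← TensorProduct.smul_tmul']
        rcases zmod2_cases p with rfl | rfl <;>
          rcases zmod2_cases i with rfl | rfl <;>
          rcases zmod2_cases j with rfl | rfl <;>
          rcases zmod2_cases k with rfl | rfl <;>
          simp only [zmod2_one_add_one, add_zero, zero_add, ksign_00, ksign_01, ksign_10, ksign_11,
            one_smul, neg_smul, smul_neg, smul_add, smul_sub, neg_neg] <;> abel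
  | cur i j x a hp hx ha =>
    cases hY with
    | der E hE =>
      cases hZ with
      | der F hF =>
        rw [affineWittBracket_der_der, affineWittBracket_cur_der S hE hx ha,
          affineWittBracket_cur_der S hF hx ha, affineWittBracket_cur_der S (scomm_mem rfl hE hF) hx ha,
          map_neg, map_smul, LinearMap.neg_apply, LinearMap.smul_apply,
          affineWittBracket_cur_der S hF hx (hE.1 j a ha), map_neg, map_smul,
          affineWittBracket_der_cur S hE hx, ← hp]
        refine Prod.ext (by simp) ?_
        simp only [Prod.snd_add, Prod.smul_snd, Prod.snd_neg, scomm, LinearMap.sub_apply,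
          LinearMap.smul_apply, LinearMap.comp_apply, TensorProduct.tmul_add, TensorProduct.tmul_sub,
          TensorProduct.add_tmul, TensorProduct.neg_tmul, TensorProduct.tmul_smul,
          ← TensorProduct.smul_tmul']
        rcases zmod2_cases q with rfl | rfl <;>
          rcases zmod2_cases i with rfl | rfl <;>
          rcases zmod2_cases j with rfl | rfl <;>
          rcases zmod2_cases r with rfl | rfl <;>
          simp only [zmod2_one_add_one, add_zero, zero_add, ksign_00, ksign_01, ksign_10, ksign_11,
            one_smul, neg_smul, smul_neg, smul_add, smul_sub, neg_neg] <;> abel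
      | cur k l y b hr hy hb =>
        rw [affineWittBracket_der_cur S hE hy, affineWittBracket_cur_der S hE hx ha,
          affineWittBracket_cur_cur S x hy ha, map_smul, affineWittBracket_cur_cur S x hy ha,
          map_neg, map_smul, LinearMap.neg_apply, LinearMap.smul_apply,
          affineWittBracket_cur_cur S x hy (hE.1 j a ha), map_smul,
          affineWittBracket_der_cur S hE (S.bracket_mem i k x y hx hy), ← hp, hE.2 j a b ha]
        refine Prod.ext (by simp) ?_
        simp only [Prod.snd_add, Prod.smul_snd, Prod.snd_neg, scomm, LinearMap.sub_apply,
          LinearMap.smul_apply, LinearMap.comp_apply, TensorProduct.tmul_add, TensorProduct.tmul_sub,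
          TensorProduct.add_tmul, TensorProduct.neg_tmul, TensorProduct.tmul_smul,
          ← TensorProduct.smul_tmul']
        rcases zmod2_cases q with rfl | rfl <;>
          rcases zmod2_cases i with rfl | rfl <;>
          rcases zmod2_cases j with rfl | rfl <;>
          rcases zmod2_cases k with rfl | rfl <;>
          simp only [zmod2_one_add_one, add_zero, zero_add, ksign_00, ksign_01, ksign_10, ksign_11,
            one_smul, neg_smul, smul_neg, smul_add, smul_sub, neg_neg] <;> abel
    | cur k l y b hq hy hb =>
      cases hZ with
      | der F hF =>
        rw [affineWittBracket_cur_der S hF hy hb, affineWittBracket_cur_cur S x hy ha,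
          affineWittBracket_cur_der S hF hx ha, map_neg, map_smul, affineWittBracket_cur_cur S x hy ha,
          map_smul, LinearMap.smul_apply,
          affineWittBracket_cur_der S hF (S.bracket_mem i k x y hx hy) (SLaurent.mul_mem_par ha hb),
          map_neg, map_smul, affineWittBracket_cur_cur S y hx hb, ← hp, ← hq, hF.2 j a b ha,
          S.skew k i y x hy hx, SLaurent.mul_comm_par hb (hF.1 j a ha)]
        refine Prod.ext (by simp) ?_
        simp only [Prod.snd_add, Prod.smul_snd, Prod.snd_neg, scomm, LinearMap.sub_apply,
          LinearMap.smul_apply, LinearMap.comp_apply, TensorProduct.tmul_add, TensorProduct.tmul_sub,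
          TensorProduct.add_tmul, TensorProduct.neg_tmul, TensorProduct.tmul_smul,
          ← TensorProduct.smul_tmul']
        rcases zmod2_cases i with rfl | rfl <;>
          rcases zmod2_cases j with rfl | rfl <;>
          rcases zmod2_cases k with rfl | rfl <;>
          rcases zmod2_cases l with rfl | rfl <;>
          rcases zmod2_cases r with rfl | rfl <;>
          simp only [zmod2_one_add_one, add_zero, zero_add, ksign_00, ksign_01, ksign_10, ksign_11,
            one_smul, neg_smul, smul_neg, smul_add, smul_sub, neg_neg] <;> abel
      | cur m n z c hr hz hc =>
        rw [affineWittBracket_cur_cur S y hz hb, affineWittBracket_cur_cur S x hy ha,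
          affineWittBracket_cur_cur S x hz ha, map_smul,
          affineWittBracket_cur_cur S x (S.bracket_mem k m y z hy hz) ha, map_smul,
          LinearMap.smul_apply, affineWittBracket_cur_cur S _ hz (SLaurent.mul_mem_par ha hb),
          map_smul, affineWittBracket_cur_cur S y (S.bracket_mem i m x z hx hz) hb, ← hp, ← hq,
          S.jacobi i k x y z hx hy, ← mul_assoc b a c, SLaurent.mul_comm_par hb ha, ← mul_assoc a b c,
          smul_mul_assoc]
        refine Prod.ext (by simp) ?_
        simp only [Prod.snd_add, Prod.smul_snd, Prod.snd_neg, scomm, LinearMap.sub_apply,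
          LinearMap.smul_apply, LinearMap.comp_apply, TensorProduct.tmul_add, TensorProduct.tmul_sub,
          TensorProduct.add_tmul, TensorProduct.neg_tmul, TensorProduct.tmul_smul,
          ← TensorProduct.smul_tmul']
        rcases zmod2_cases i with rfl | rfl <;>
          rcases zmod2_cases j with rfl | rfl <;>
          rcases zmod2_cases k with rfl | rfl <;>
          rcases zmod2_cases l with rfl | rfl <;>
          rcases zmod2_cases m with rfl | rfl <;>
          simp only [zmod2_one_add_one, add_zero, zero_add, ksign_00, ksign_01, ksign_10, ksign_11,
            one_smul, neg_smul, smul_neg, smul_add, smul_sub, neg_neg] <;> abel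

/-- The Lie superalgebra `ℒ = 𝒲 ⋉ (𝔤 ⊗ 𝒜)`. -/
def affineWitt : LieSuperalgebra (AffineWitt g) where
  par := S.affineWittPar
  isCompl := S.affineWitt_isCompl
  bracket := S.affineWittBracket
  bracket_mem := by
    intro p q X Y hX hY
    rw [← span_gen] at hX hY
    induction hX using Submodule.span_induction with
    | mem X hX =>
      induction hY using Submodule.span_induction with
      | mem Y hY => exact S.bracket_mem_gen hX hY
      | zero => simp
      | add Y Z _ _ h1 h2 => rw [map_add]; exact Submodule.add_mem _ h1 h2
      | smul c Y _ h => rw [map_smul]; exact Submodule.smul_mem _ c h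
    | zero => simp
    | add X Z _ _ h1 h2 => rw [map_add]; exact Submodule.add_mem _ h1 h2
    | smul c X _ h => rw [map_smul]; exact Submodule.smul_mem _ c h
  skew := by
    intro p q X Y hX hY
    rw [← span_gen] at hX hY
    induction hX using Submodule.span_induction with
    | mem X hX =>
      induction hY using Submodule.span_induction with
      | mem Y hY => exact S.skew_gen hX hY
      | zero => simp only [map_zero, LinearMap.zero_apply, smul_zero, neg_zero]
      | add Y Z _ _ h1 h2 =>
        simp only [map_add, LinearMap.add_apply, h1, h2, smul_add, neg_add]
      | smul c Y _ h =>
        simp only [map_smul, LinearMap.smul_apply, h, smul_neg, smul_comm c]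
    | zero => simp only [map_zero, LinearMap.zero_apply, smul_zero, neg_zero]
    | add X Z _ _ h1 h2 =>
      simp only [map_add, LinearMap.add_apply, h1, h2, smul_add, neg_add]
    | smul c X _ h =>
      simp only [map_smul, LinearMap.smul_apply, h, smul_neg, smul_comm c]
  jacobi := by
    intro p q X Y Z hX hY
    obtain ⟨Z1, hZ1, Z2, hZ2, rfl⟩ := Submodule.mem_sup.1
      (S.affineWitt_isCompl.sup_eq_top ▸ Submodule.mem_top :
        Z ∈ S.affineWittPar 0 ⊔ S.affineWittPar 1)
    have key : ∀ (r : ZMod 2) (W : AffineWitt g), W ∈ S.affineWittPar r →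
        S.affineWittBracket X (S.affineWittBracket Y W) =
          S.affineWittBracket (S.affineWittBracket X Y) W +
            ksign p q • S.affineWittBracket Y (S.affineWittBracket X W) := by
      intro r W hW
      rw [← span_gen] at hX hY hW
      induction hX using Submodule.span_induction with
      | mem X hX =>
        induction hY using Submodule.span_induction with
        | mem Y hY =>
          induction hW using Submodule.span_induction with
          | mem W hW => exact S.jacobi_gen hX hY hW
          | zero => simp only [map_zero, smul_zero, add_zero]
          | add W Z _ _ h1 h2 => simp only [map_add, h1, h2, smul_add]; abel
          | smul c W _ h => simp only [map_smul, h, smul_add, smul_comm c]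
        | zero => simp only [map_zero, LinearMap.zero_apply, smul_zero, add_zero]
        | add Y Z _ _ h1 h2 =>
          simp only [map_add, LinearMap.add_apply, h1, h2, smul_add]; abel
        | smul c Y _ h =>
          simp only [map_smul, LinearMap.smul_apply, h, smul_add, smul_comm c]
      | zero => simp only [map_zero, LinearMap.zero_apply, smul_zero, add_zero]
      | add X Z _ _ h1 h2 =>
        simp only [map_add, LinearMap.add_apply, h1, h2, smul_add]; abel
      | smul c X _ h =>
        simp only [map_smul, LinearMap.smul_apply, h, smul_add, smul_comm c]
    simp only [map_add, key 0 Z1 hZ1, key 1 Z2 hZ2, smul_add]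
    abel

end Main

end LieSuperalgebra

/-! ### Elements of `ℒ ⊕ ℂ C` -/

namespace SuperAffineVirasoro

variable (g : Type u) [AddCommGroup g] [Module ℂ g]

/-- The inclusion of `𝒲` into `ℒ ⊕ ℂ C`. -/
def witt : Witt →ₗ[ℂ] AffineWitt g × ℂ :=
  LinearMap.inl ℂ (AffineWitt g) ℂ ∘ₗ LinearMap.inl ℂ Witt (g ⊗[ℂ] SLaurent)

variable {g} in
/-- The inclusion of `𝔤 ⊗ 𝒜` into `ℒ ⊕ ℂ C`. -/
def loop : (g ⊗[ℂ] SLaurent) →ₗ[ℂ] AffineWitt g × ℂ :=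
  LinearMap.inl ℂ (AffineWitt g) ℂ ∘ₗ LinearMap.inr ℂ Witt (g ⊗[ℂ] SLaurent)

/-- The central element `C`. -/
def C : AffineWitt g × ℂ := (0, 1)

/-- The element `d_i` of `ℒ ⊕ ℂ C`. -/
def d (i : ℤ) : AffineWitt g × ℂ := witt g (Witt.d i)

/-- The element `h_i` of `ℒ ⊕ ℂ C`. -/
def h (i : ℤ) : AffineWitt g × ℂ := witt g (Witt.h i)

/-- The element `Q_i` of `ℒ ⊕ ℂ C`. -/
def Q (i : ℤ) : AffineWitt g × ℂ := witt g (Witt.Q i)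

/-- The element `G_i` of `ℒ ⊕ ℂ C`. -/
def G (i : ℤ) : AffineWitt g × ℂ := witt g (Witt.G i)

variable {g}

/-- The element `x ⊗ t^i` of `ℒ ⊕ ℂ C`. -/
def xt (x : g) (i : ℤ) : AffineWitt g × ℂ := loop (x ⊗ₜ[ℂ] SLaurent.t i)

/-- The element `x ⊗ t^i ξ` of `ℒ ⊕ ℂ C`. -/
def xtξ (x : g) (i : ℤ) : AffineWitt g × ℂ := loop (x ⊗ₜ[ℂ] SLaurent.tξ i)

end SuperAffineVirasoro

end

set_option linter.unnecessarySeqFocus false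

noncomputable section

open SLaurent

/-! ### Linear algebra of `𝒜` in the basis `t^n`, `t^n ξ` -/

namespace SLaurent

/-! The brackets with `d_0` and `h_0` act diagonally on `ℒ`. The first gives the degree in `t`; the
second gives a charge, which is `0` on `d_i`, `h_i`, `x ⊗ t^i`, is `-1` on `Q_i`, and is `+1` on
`G_i`, `x ⊗ t^i ξ`. A cocycle `f` that vanishes against `d_0` and `h_0` therefore pairs only vectors
of opposite degree and opposite charge (`eq_zero_of_eigenvalues`). Subtracting a coboundary achieves
this vanishing, and the freedom left in degree zero is spent on a few further values
(`IsNormalized`).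

On `𝒲`, what survives is governed by one functional equation (`apply_h_d_add`) between `f(h_i,
d_{-i})`, `f(h_i, h_{-i})` and `f(Q_i, G_{-i})`, which reduces everything to values at `i = 1` and
`i = -1`. The value `f(h_1, h_{-1})` cannot be altered by a coboundary, since `[h_1, h_{-1}] = 0`.
It is removed by a multiple of the explicit cocycle, whose value there is `2`. On `𝔤 ⊗ 𝒜` nothing
survives, not even a cocycle of affine type: `x ⊗ t^i` is a bracket of `Q_0` with an element of `𝔤 ⊗
t^i ξ`, so the values on pairs `x ⊗ t^i`, `y ⊗ t^{-i}` reduce to `f(Q_0, 𝔤 ⊗ ξ)`, which is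
normalized to zero. Perfectness of `𝔤` then kills the mixed values. Hence normalized cocycles vanish
(`eq_zero_of_isNormalized`), and every cocycle is a multiple of the explicit one plus a coboundary
(`exists_eq_cocycle_add_coboundary`).

The argument allows coefficients in any vector space `M`. For `M = ℂ` it bounds the dimension of
`H²` by one. For `M` the kernel of a central extension it yields the homomorphism that universality
asks for; its uniqueness follows from the perfectness of `ℒ ⊕ ℂ C` (`isPerfect_centralExtension`,
`hom_unique`). -/

theorem euler_T (n : ℤ) : euler (LaurentPolynomial.T n) = (n : ℂ) • LaurentPolynomial.T n :=
  (AddMonoidAlgebra.basis ℤ ℂ).constr_basis ℂ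
    (fun n : ℤ => (n : ℂ) • (LaurentPolynomial.T n : ℂ[T;T⁻¹])) n

@[simp] theorem tdt_t (n : ℤ) : tdt (t n) = (n : ℂ) • t n := by
  ext1 <;> simp [tdt, t, euler_T]

@[simp] theorem tdt_tξ (n : ℤ) : tdt (tξ n) = (n : ℂ) • tξ n := by
  ext1 <;> simp [tdt, tξ, euler_T]

@[simp] theorem dξ_t (n : ℤ) : dξ (t n) = 0 := by
  ext1 <;> simp [dξ, t]

@[simp] theorem dξ_tξ (n : ℤ) : dξ (tξ n) = t n := by
  ext1 <;> simp [dξ, t, tξ]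

@[simp] theorem t_mul_t (m n : ℤ) : t m * t n = t (m + n) := by
  rw [t, t, t, ← TrivSqZeroExt.inl_mul, LaurentPolynomial.T_add]

@[simp] theorem t_mul_tξ (m n : ℤ) : t m * tξ n = tξ (m + n) := by
  rw [t, tξ, tξ, TrivSqZeroExt.inl_mul_inr, LaurentPolynomial.T_add, smul_eq_mul]

@[simp] theorem tξ_mul_t (m n : ℤ) : tξ m * t n = tξ (m + n) := by
  rw [mul_comm, t_mul_tξ, add_comm]

@[simp] theorem tξ_mul_tξ (m n : ℤ) : tξ m * tξ n = 0 :=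
  TrivSqZeroExt.inr_mul_inr _ _ _

theorem t_zero : t 0 = 1 := by
  ext1 <;> simp [t]

/-- The linear map out of `ℂ[t, t⁻¹]` with prescribed values on the powers of `t`. -/
def laurentLift {N : Type*} [AddCommGroup N] [Module ℂ N] (f : ℤ → N) : ℂ[T;T⁻¹] →ₗ[ℂ] N :=
  (AddMonoidAlgebra.basis ℤ ℂ).constr ℂ f

@[simp] theorem laurentLift_T {N : Type*} [AddCommGroup N] [Module ℂ N] (f : ℤ → N) (n : ℤ) :
    laurentLift f (LaurentPolynomial.T n) = f n :=
  (AddMonoidAlgebra.basis ℤ ℂ).constr_basis ℂ f n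

theorem laurentLift_mem_span {N : Type*} [AddCommGroup N] [Module ℂ N] (f : ℤ → N)
    (a : ℂ[T;T⁻¹]) : laurentLift f a ∈ Submodule.span ℂ (Set.range f) := by
  rw [← (AddMonoidAlgebra.basis ℤ ℂ).constr_range ℂ]
  exact ⟨a, rfl⟩

theorem laurent_hom_ext {N : Type*} [AddCommGroup N] [Module ℂ N] {φ ψ : ℂ[T;T⁻¹] →ₗ[ℂ] N}
    (h : ∀ n, φ (LaurentPolynomial.T n) = ψ (LaurentPolynomial.T n)) : φ = ψ :=
  (AddMonoidAlgebra.basis ℤ ℂ).ext h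

/-- The inclusion of the even part, as a linear map. -/
def inlL : ℂ[T;T⁻¹] →ₗ[ℂ] SLaurent where
  toFun f := TrivSqZeroExt.inl f
  map_add' f g := by ext <;> simp
  map_smul' c f := by ext <;> simp

/-- The inclusion of the odd part, as a linear map. -/
def inrL : ℂ[T;T⁻¹] →ₗ[ℂ] SLaurent where
  toFun f := TrivSqZeroExt.inr f
  map_add' f g := by ext <;> simp
  map_smul' c f := by ext <;> simp

/-- The even coordinate, as a linear map. -/
def fstL : SLaurent →ₗ[ℂ] ℂ[T;T⁻¹] where
  toFun a := a.fst
  map_add' f g := by simp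
  map_smul' c f := by simp

/-- The odd coordinate, as a linear map. -/
def sndL : SLaurent →ₗ[ℂ] ℂ[T;T⁻¹] where
  toFun a := a.snd
  map_add' f g := by simp
  map_smul' c f := by simp

theorem inlL_fstL_add_inrL_sndL (a : SLaurent) : inlL (fstL a) + inrL (sndL a) = a :=
  TrivSqZeroExt.inl_fst_add_inr_snd_eq a

@[simp] theorem fstL_t (n : ℤ) : fstL (t n) = LaurentPolynomial.T n := rfl
@[simp] theorem fstL_tξ (n : ℤ) : fstL (tξ n) = 0 := rfl
@[simp] theorem sndL_t (n : ℤ) : sndL (t n) = 0 := rfl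
@[simp] theorem sndL_tξ (n : ℤ) : sndL (tξ n) = LaurentPolynomial.T n := rfl

/-- Linear maps out of `𝒜` that agree on all `t^n` and `t^n ξ` are equal. -/
theorem hom_ext {N : Type*} [AddCommGroup N] [Module ℂ N] {φ ψ : SLaurent →ₗ[ℂ] N}
    (h0 : ∀ n, φ (t n) = ψ (t n)) (h1 : ∀ n, φ (tξ n) = ψ (tξ n)) : φ = ψ := by
  have e0 : φ ∘ₗ inlL = ψ ∘ₗ inlL := laurent_hom_ext h0
  have e1 : φ ∘ₗ inrL = ψ ∘ₗ inrL := laurent_hom_ext h1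
  ext1 a
  rw [← inlL_fstL_add_inrL_sndL a, map_add, map_add]
  exact congrArg₂ (· + ·) (LinearMap.congr_fun e0 _) (LinearMap.congr_fun e1 _)

/-- The linear map out of `𝒜` with prescribed values on all `t^n` and `t^n ξ`. -/
def lift {N : Type*} [AddCommGroup N] [Module ℂ N] (u v : ℤ → N) : SLaurent →ₗ[ℂ] N :=
  laurentLift u ∘ₗ fstL + laurentLift v ∘ₗ sndL

@[simp] theorem lift_t {N : Type*} [AddCommGroup N] [Module ℂ N] (u v : ℤ → N) (n : ℤ) :
    lift u v (t n) = u n := by simp [lift]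

@[simp] theorem lift_tξ {N : Type*} [AddCommGroup N] [Module ℂ N] (u v : ℤ → N) (n : ℤ) :
    lift u v (tξ n) = v n := by simp [lift]

/-- A superderivation that kills `t` and `ξ` is zero. -/
theorem superDer_eq_zero {p : ZMod 2} {D : SLaurent →ₗ[ℂ] SLaurent} (hD : D ∈ superDer p)
    (h0 : D (t 1) = 0) (h1 : D (tξ 0) = 0) : D = 0 := by
  have hmul : ∀ (m : ℤ) (b : SLaurent), D (t m * b) = D (t m) * b + t m * D b := by
    intro m b
    have hk : ksign p 0 = 1 := by simp [ksign]
    simpa [hk] using hD.2 0 (t m) b (t_mem m)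
  have hone : D (t 0) = 0 := by
    have h := hmul 0 (t 0)
    simpa [t_zero] using h
  -- Differentiate `t · t⁻¹ = 1`, then cancel the invertible factor `t`.
  have hneg : D (t (-1)) = 0 := by
    have h := hmul 1 (t (-1))
    rw [t_mul_t, add_neg_cancel, hone, h0, zero_mul, zero_add] at h
    have h2 := congrArg (t (-1) * ·) h.symm
    simpa [← mul_assoc, t_zero] using h2
  have ht : ∀ n : ℤ, D (t n) = 0 := by
    intro n
    induction n with
    | zero => exact hone
    | succ n ih =>
      have h := hmul n (t 1)
      simpa [ih, h0] using h
    | pred n ih =>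
      have h := hmul (-n) (t (-1))
      simpa [ih, hneg, ← sub_eq_add_neg] using h
  refine hom_ext (fun n => by simp [ht]) fun n => ?_
  have h := hmul n (tξ 0)
  simpa [ht, h1] using h

end SLaurent

/-! ### Coordinates and brackets on the Witt superalgebra -/

namespace Witt

/-- The coefficient of `t ∂/∂t` in the even component. -/
def coordD : Witt →ₗ[ℂ] ℂ[T;T⁻¹] :=
  -- The field `c · t ∂/∂t` sends `t` to `c t`; the factor `t⁻¹` recovers `c`.
  LinearMap.mulLeft ℂ (LaurentPolynomial.T (-1)) ∘ₗ fstL ∘ₗ LinearMap.applyₗ (t 1) ∘ₗ even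

/-- The coefficient of `ξ ∂/∂ξ` in the even component. -/
def coordH : Witt →ₗ[ℂ] ℂ[T;T⁻¹] :=
  sndL ∘ₗ LinearMap.applyₗ (tξ 0) ∘ₗ even

/-- The coefficient of `∂/∂ξ` in the odd component. -/
def coordQ : Witt →ₗ[ℂ] ℂ[T;T⁻¹] :=
  fstL ∘ₗ LinearMap.applyₗ (tξ 0) ∘ₗ odd

/-- The coefficient of `t ξ ∂/∂t` in the odd component. -/
def coordG : Witt →ₗ[ℂ] ℂ[T;T⁻¹] :=
  LinearMap.mulLeft ℂ (LaurentPolynomial.T (-1)) ∘ₗ sndL ∘ₗ LinearMap.applyₗ (t 1) ∘ₗ odd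

@[simp] theorem even_d (i : ℤ) : even (d i) = LinearMap.mulLeft ℂ (t i) ∘ₗ tdt := rfl
@[simp] theorem even_h (i : ℤ) : even (h i) = LinearMap.mulLeft ℂ (tξ i) ∘ₗ dξ := rfl
@[simp] theorem even_Q (i : ℤ) : even (Q i) = 0 := rfl
@[simp] theorem even_G (i : ℤ) : even (G i) = 0 := rfl
@[simp] theorem odd_d (i : ℤ) : odd (d i) = 0 := rfl
@[simp] theorem odd_h (i : ℤ) : odd (h i) = 0 := rfl
@[simp] theorem odd_Q (i : ℤ) : odd (Q i) = LinearMap.mulLeft ℂ (t i) ∘ₗ dξ := rfl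
@[simp] theorem odd_G (i : ℤ) : odd (G i) = LinearMap.mulLeft ℂ (tξ i) ∘ₗ tdt := rfl

theorem T_neg_one_mul_T (i : ℤ) :
    (LaurentPolynomial.T (-1) * LaurentPolynomial.T (i + 1) : ℂ[T;T⁻¹]) = LaurentPolynomial.T i := by
  rw [← LaurentPolynomial.T_add]; congr 1; ring

@[simp] theorem coordD_d (i : ℤ) : coordD (d i) = LaurentPolynomial.T i := by
  simp only [coordD, LinearMap.comp_apply, LinearMap.applyₗ_apply_apply, even_d,
    LinearMap.mulLeft_apply, tdt_t, Int.cast_one, one_smul, t_mul_t, fstL_t, T_neg_one_mul_T]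
@[simp] theorem coordD_h (i : ℤ) : coordD (h i) = 0 := by simp [coordD]
@[simp] theorem coordD_Q (i : ℤ) : coordD (Q i) = 0 := by simp [coordD]
@[simp] theorem coordD_G (i : ℤ) : coordD (G i) = 0 := by simp [coordD]
@[simp] theorem coordH_d (i : ℤ) : coordH (d i) = 0 := by simp [coordH]
@[simp] theorem coordH_h (i : ℤ) : coordH (h i) = LaurentPolynomial.T i := by simp [coordH]
@[simp] theorem coordH_Q (i : ℤ) : coordH (Q i) = 0 := by simp [coordH]
@[simp] theorem coordH_G (i : ℤ) : coordH (G i) = 0 := by simp [coordH]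
@[simp] theorem coordQ_d (i : ℤ) : coordQ (d i) = 0 := by simp [coordQ]
@[simp] theorem coordQ_h (i : ℤ) : coordQ (h i) = 0 := by simp [coordQ]
@[simp] theorem coordQ_Q (i : ℤ) : coordQ (Q i) = LaurentPolynomial.T i := by simp [coordQ]
@[simp] theorem coordQ_G (i : ℤ) : coordQ (G i) = 0 := by simp [coordQ]
@[simp] theorem coordG_d (i : ℤ) : coordG (d i) = 0 := by simp [coordG]
@[simp] theorem coordG_h (i : ℤ) : coordG (h i) = 0 := by simp [coordG]
@[simp] theorem coordG_Q (i : ℤ) : coordG (Q i) = 0 := by simp [coordG]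
@[simp] theorem coordG_G (i : ℤ) : coordG (G i) = LaurentPolynomial.T i := by
  simp only [coordG, LinearMap.comp_apply, LinearMap.applyₗ_apply_apply, odd_G,
    LinearMap.mulLeft_apply, tdt_t, Int.cast_one, one_smul, tξ_mul_t, sndL_tξ, T_neg_one_mul_T]

/-- The linear map out of `𝒲` with prescribed values on all `d_i`, `h_i`, `Q_i`, `G_i`. -/
def lift {N : Type*} [AddCommGroup N] [Module ℂ N] (fd fh fQ fG : ℤ → N) : Witt →ₗ[ℂ] N :=
  laurentLift fd ∘ₗ coordD + laurentLift fh ∘ₗ coordH + laurentLift fQ ∘ₗ coordQ +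
    laurentLift fG ∘ₗ coordG

section lift

variable {N : Type*} [AddCommGroup N] [Module ℂ N] (fd fh fQ fG : ℤ → N) (i : ℤ)

@[simp] theorem lift_d : lift fd fh fQ fG (d i) = fd i := by simp [lift]
@[simp] theorem lift_h : lift fd fh fQ fG (h i) = fh i := by simp [lift]
@[simp] theorem lift_Q : lift fd fh fQ fG (Q i) = fQ i := by simp [lift]
@[simp] theorem lift_G : lift fd fh fQ fG (G i) = fG i := by simp [lift]

end lift

theorem T_neg_one_mul_eq_zero {f : ℂ[T;T⁻¹]} (hf : LaurentPolynomial.T (-1) * f = 0) : f = 0 := by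
  have h := congrArg (LaurentPolynomial.T 1 * ·) hf
  simpa only [← mul_assoc, ← LaurentPolynomial.T_add, add_neg_cancel, LaurentPolynomial.T_zero,
    one_mul, mul_zero] using h

/-- A superderivation is determined by its coordinates. -/
theorem eq_zero_of_coord {X : Witt} (hd : coordD X = 0) (hh : coordH X = 0) (hQ : coordQ X = 0)
    (hG : coordG X = 0) : X = 0 := by
  have h0 := T_neg_one_mul_eq_zero hd
  have h1 := T_neg_one_mul_eq_zero hG
  refine ext (superDer_eq_zero X.even_mem ?_ ?_) (superDer_eq_zero X.odd_mem ?_ ?_)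
  -- In each case one component of the value at `t` or `ξ` is a coordinate, and the other vanishes
  -- by parity.
  · exact TrivSqZeroExt.ext h0 (X.even_mem.1 0 _ (t_mem 1))
  · exact TrivSqZeroExt.ext (X.even_mem.1 1 _ (tξ_mem 0)) hh
  · exact TrivSqZeroExt.ext (X.odd_mem.1 0 _ (t_mem 1)) h1
  · exact TrivSqZeroExt.ext hQ (X.odd_mem.1 1 _ (tξ_mem 0))

theorem map_laurentLift {N P : Type*} [AddCommGroup N] [Module ℂ N] [AddCommGroup P] [Module ℂ P]
    (φ : N →ₗ[ℂ] P) (f : ℤ → N) (a : ℂ[T;T⁻¹]) :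
    φ (laurentLift f a) = laurentLift (fun n => φ (f n)) a :=
  LinearMap.congr_fun (laurent_hom_ext (φ := φ ∘ₗ laurentLift f) fun n => by simp) a

theorem laurentLift_zero {N : Type*} [AddCommGroup N] [Module ℂ N] (a : ℂ[T;T⁻¹]) :
    laurentLift (fun _ => (0 : N)) a = 0 :=
  LinearMap.congr_fun (laurent_hom_ext (φ := laurentLift fun _ => (0 : N)) (ψ := 0)
    fun n => by simp) a

theorem laurentLift_self (a : ℂ[T;T⁻¹]) : laurentLift LaurentPolynomial.T a = a :=
  LinearMap.congr_fun (laurent_hom_ext (φ := laurentLift LaurentPolynomial.T) (ψ := LinearMap.id)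
    fun n => by simp) a

/-- Every superderivation is a combination of the `d_i`, `h_i`, `Q_i`, `G_i`. -/
theorem lift_self (X : Witt) : lift d h Q G X = X := by
  rw [← sub_eq_zero]
  apply eq_zero_of_coord <;>
    simp [lift, map_laurentLift, laurentLift_zero, laurentLift_self]

/-- The coordinates are Laurent polynomials, so the expansion in `lift_self` is a finite sum. -/
theorem span_eq_top :
    Submodule.span ℂ (Set.range d ∪ Set.range h ∪ Set.range Q ∪ Set.range G) = ⊤ := by
  rw [eq_top_iff]
  intro X _
  rw [← lift_self X]
  simp only [Submodule.span_union]
  exact Submodule.add_mem_sup (Submodule.add_mem_sup (Submodule.add_mem_sup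
    (laurentLift_mem_span d _) (laurentLift_mem_span h _)) (laurentLift_mem_span Q _))
    (laurentLift_mem_span G _)

theorem hom_ext {N : Type*} [AddCommGroup N] [Module ℂ N] {φ ψ : Witt →ₗ[ℂ] N}
    (hd : ∀ i, φ (d i) = ψ (d i)) (hh : ∀ i, φ (h i) = ψ (h i)) (hQ : ∀ i, φ (Q i) = ψ (Q i))
    (hG : ∀ i, φ (G i) = ψ (G i)) : φ = ψ := by
  refine LinearMap.ext_on span_eq_top ?_
  rintro _ (((⟨i, rfl⟩ | ⟨i, rfl⟩) | ⟨i, rfl⟩) | ⟨i, rfl⟩)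
  exacts [hd i, hh i, hQ i, hG i]

theorem par_zero_le : par 0 ≤ Submodule.span ℂ (Set.range d ∪ Set.range h) := by
  intro X hX
  have h0 : odd X = 0 := by simpa [par] using hX
  have e : lift d h Q G X = laurentLift d (coordD X) + laurentLift h (coordH X) := by
    simp [lift, coordQ, coordG, h0]
  rw [← lift_self X, e, Submodule.span_union]
  exact Submodule.add_mem_sup (laurentLift_mem_span d _) (laurentLift_mem_span h _)

theorem par_one_le : par 1 ≤ Submodule.span ℂ (Set.range Q ∪ Set.range G) := by
  intro X hX
  have h0 : even X = 0 := by simpa [par] using hX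
  have e : lift d h Q G X = laurentLift Q (coordQ X) + laurentLift G (coordG X) := by
    simp [lift, coordD, coordH, h0]
  rw [← lift_self X, e, Submodule.span_union]
  exact Submodule.add_mem_sup (laurentLift_mem_span Q _) (laurentLift_mem_span G _)

theorem even_bracket (X Y : Witt) :
    even (bracket X Y) = scomm 0 0 (even X) (even Y) + scomm 1 1 (odd X) (odd Y) := rfl

theorem odd_bracket (X Y : Witt) :
    odd (bracket X Y) = scomm 0 1 (even X) (odd Y) + scomm 1 0 (odd X) (even Y) := rfl

section brackets

variable (i j : ℤ)

-- This and the following brackets are identities between operators on `𝒜`; the even and the odd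
-- component are each compared on `t^n` and on `t^n ξ`.
@[simp] theorem bracket_d_d : bracket (d i) (d j) = ((j : ℂ) - i) • d (i + j) := by
  refine ext (SLaurent.hom_ext ?_ ?_) (SLaurent.hom_ext ?_ ?_) <;> intro n <;>
    simp [even_bracket, odd_bracket, scomm, ksign_00, ksign_01, ksign_10, ksign_11, smul_smul,
      add_assoc, add_left_comm j i] <;> module

@[simp] theorem bracket_d_h : bracket (d i) (h j) = (j : ℂ) • h (i + j) := by
  refine ext (SLaurent.hom_ext ?_ ?_) (SLaurent.hom_ext ?_ ?_) <;> intro n <;>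
    simp [even_bracket, odd_bracket, scomm, ksign_00, ksign_01, ksign_10, ksign_11, smul_smul,
      add_assoc, add_left_comm j i] <;> module

@[simp] theorem bracket_d_Q : bracket (d i) (Q j) = (j : ℂ) • Q (i + j) := by
  refine ext (SLaurent.hom_ext ?_ ?_) (SLaurent.hom_ext ?_ ?_) <;> intro n <;>
    simp [even_bracket, odd_bracket, scomm, ksign_00, ksign_01, ksign_10, ksign_11, smul_smul,
      add_assoc, add_left_comm j i] <;> module

@[simp] theorem bracket_d_G : bracket (d i) (G j) = ((j : ℂ) - i) • G (i + j) := by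
  refine ext (SLaurent.hom_ext ?_ ?_) (SLaurent.hom_ext ?_ ?_) <;> intro n <;>
    simp [even_bracket, odd_bracket, scomm, ksign_00, ksign_01, ksign_10, ksign_11, smul_smul,
      add_assoc, add_left_comm j i] <;> module

@[simp] theorem bracket_h_d : bracket (h i) (d j) = -((i : ℂ) • h (i + j)) := by
  refine ext (SLaurent.hom_ext ?_ ?_) (SLaurent.hom_ext ?_ ?_) <;> intro n <;>
    simp [even_bracket, odd_bracket, scomm, ksign_00, ksign_01, ksign_10, ksign_11, smul_smul,
      add_assoc, add_left_comm j i] <;> module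

@[simp] theorem bracket_h_h : bracket (h i) (h j) = 0 := by
  refine ext (SLaurent.hom_ext ?_ ?_) (SLaurent.hom_ext ?_ ?_) <;> intro n <;>
    simp [even_bracket, odd_bracket, scomm, ksign_00, ksign_01, ksign_10, ksign_11, smul_smul,
      add_assoc, add_left_comm j i] <;> module

@[simp] theorem bracket_h_Q : bracket (h i) (Q j) = -Q (i + j) := by
  refine ext (SLaurent.hom_ext ?_ ?_) (SLaurent.hom_ext ?_ ?_) <;> intro n <;>
    simp [even_bracket, odd_bracket, scomm, ksign_00, ksign_01, ksign_10, ksign_11, smul_smul,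
      add_assoc, add_left_comm j i] <;> module

@[simp] theorem bracket_h_G : bracket (h i) (G j) = G (i + j) := by
  refine ext (SLaurent.hom_ext ?_ ?_) (SLaurent.hom_ext ?_ ?_) <;> intro n <;>
    simp [even_bracket, odd_bracket, scomm, ksign_00, ksign_01, ksign_10, ksign_11, smul_smul,
      add_assoc, add_left_comm j i] <;> module

@[simp] theorem bracket_Q_d : bracket (Q i) (d j) = -((i : ℂ) • Q (i + j)) := by
  refine ext (SLaurent.hom_ext ?_ ?_) (SLaurent.hom_ext ?_ ?_) <;> intro n <;>
    simp [even_bracket, odd_bracket, scomm, ksign_00, ksign_01, ksign_10, ksign_11, smul_smul,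
      add_assoc, add_left_comm j i] <;> module

@[simp] theorem bracket_Q_h : bracket (Q i) (h j) = Q (i + j) := by
  refine ext (SLaurent.hom_ext ?_ ?_) (SLaurent.hom_ext ?_ ?_) <;> intro n <;>
    simp [even_bracket, odd_bracket, scomm, ksign_00, ksign_01, ksign_10, ksign_11, smul_smul,
      add_assoc, add_left_comm j i] <;> module

@[simp] theorem bracket_Q_Q : bracket (Q i) (Q j) = 0 := by
  refine ext (SLaurent.hom_ext ?_ ?_) (SLaurent.hom_ext ?_ ?_) <;> intro n <;>
    simp [even_bracket, odd_bracket, scomm, ksign_00, ksign_01, ksign_10, ksign_11, smul_smul,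
      add_assoc, add_left_comm j i] <;> module

@[simp] theorem bracket_Q_G : bracket (Q i) (G j) = d (i + j) + (i : ℂ) • h (i + j) := by
  refine ext (SLaurent.hom_ext ?_ ?_) (SLaurent.hom_ext ?_ ?_) <;> intro n <;>
    simp [even_bracket, odd_bracket, scomm, ksign_00, ksign_01, ksign_10, ksign_11, smul_smul,
      add_assoc, add_left_comm j i] <;> module

@[simp] theorem bracket_G_d : bracket (G i) (d j) = ((j : ℂ) - i) • G (i + j) := by
  refine ext (SLaurent.hom_ext ?_ ?_) (SLaurent.hom_ext ?_ ?_) <;> intro n <;>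
    simp [even_bracket, odd_bracket, scomm, ksign_00, ksign_01, ksign_10, ksign_11, smul_smul,
      add_assoc, add_left_comm j i] <;> module

@[simp] theorem bracket_G_h : bracket (G i) (h j) = -G (i + j) := by
  refine ext (SLaurent.hom_ext ?_ ?_) (SLaurent.hom_ext ?_ ?_) <;> intro n <;>
    simp [even_bracket, odd_bracket, scomm, ksign_00, ksign_01, ksign_10, ksign_11, smul_smul,
      add_assoc, add_left_comm j i] <;> module

@[simp] theorem bracket_G_Q : bracket (G i) (Q j) = d (i + j) + (j : ℂ) • h (i + j) := by
  refine ext (SLaurent.hom_ext ?_ ?_) (SLaurent.hom_ext ?_ ?_) <;> intro n <;>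
    simp [even_bracket, odd_bracket, scomm, ksign_00, ksign_01, ksign_10, ksign_11, smul_smul,
      add_assoc, add_left_comm j i] <;> module

@[simp] theorem bracket_G_G : bracket (G i) (G j) = 0 := by
  refine ext (SLaurent.hom_ext ?_ ?_) (SLaurent.hom_ext ?_ ?_) <;> intro n <;>
    simp [even_bracket, odd_bracket, scomm, ksign_00, ksign_01, ksign_10, ksign_11, smul_smul,
      add_assoc, add_left_comm j i] <;> module

end brackets

end Witt

/-! ### The explicit 2-cocycle on the Witt superalgebra -/

namespace Witt

/-- The standard homogeneous generators of `𝒲`. -/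
inductive Gen : ZMod 2 → Witt → Prop
  | d (i : ℤ) : Gen 0 (d i)
  | h (i : ℤ) : Gen 0 (h i)
  | Q (i : ℤ) : Gen 1 (Q i)
  | G (i : ℤ) : Gen 1 (G i)

theorem par_le_span_gen (p : ZMod 2) : par p ≤ Submodule.span ℂ {X | Gen p X} := by
  rcases zmod2_cases p with rfl | rfl
  · refine par_zero_le.trans (Submodule.span_mono ?_)
    rintro _ (⟨i, rfl⟩ | ⟨i, rfl⟩)
    exacts [Gen.d i, Gen.h i]
  · refine par_one_le.trans (Submodule.span_mono ?_)
    rintro _ (⟨i, rfl⟩ | ⟨i, rfl⟩)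
    exacts [Gen.Q i, Gen.G i]

theorem Gen.mem_par {p : ZMod 2} {X : Witt} (hX : Gen p X) : X ∈ par p := by
  cases hX <;> simp [par]

/-- The 2-cocycle on `𝒲` that defines the central extension. -/
def cocycle : Witt →ₗ[ℂ] Witt →ₗ[ℂ] ℂ :=
  lift
    (fun i => lift 0 (fun j => if i + j = 0 then -(i : ℂ) ^ 2 else 0) 0 0)
    (fun i => lift (fun j => if i + j = 0 then (j : ℂ) ^ 2 else 0)
      (fun j => if i + j = 0 then 2 * (i : ℂ) else 0) 0 0)
    (fun i => lift 0 0 0 (fun j => if i + j = 0 then -(i : ℂ) ^ 2 else 0))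
    (fun i => lift 0 0 (fun j => if i + j = 0 then -(j : ℂ) ^ 2 else 0) 0)

section values

variable (i j : ℤ)

@[simp] theorem cocycle_d_d : cocycle (d i) (d j) = 0 := by simp [cocycle]
@[simp] theorem cocycle_d_h :
    cocycle (d i) (h j) = if i + j = 0 then -(i : ℂ) ^ 2 else 0 := by simp [cocycle]
@[simp] theorem cocycle_d_Q : cocycle (d i) (Q j) = 0 := by simp [cocycle]
@[simp] theorem cocycle_d_G : cocycle (d i) (G j) = 0 := by simp [cocycle]
@[simp] theorem cocycle_h_d :
    cocycle (h i) (d j) = if i + j = 0 then (j : ℂ) ^ 2 else 0 := by simp [cocycle]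
@[simp] theorem cocycle_h_h :
    cocycle (h i) (h j) = if i + j = 0 then 2 * (i : ℂ) else 0 := by simp [cocycle]
@[simp] theorem cocycle_h_Q : cocycle (h i) (Q j) = 0 := by simp [cocycle]
@[simp] theorem cocycle_h_G : cocycle (h i) (G j) = 0 := by simp [cocycle]
@[simp] theorem cocycle_Q_d : cocycle (Q i) (d j) = 0 := by simp [cocycle]
@[simp] theorem cocycle_Q_h : cocycle (Q i) (h j) = 0 := by simp [cocycle]
@[simp] theorem cocycle_Q_Q : cocycle (Q i) (Q j) = 0 := by simp [cocycle]
@[simp] theorem cocycle_Q_G :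
    cocycle (Q i) (G j) = if i + j = 0 then -(i : ℂ) ^ 2 else 0 := by simp [cocycle]
@[simp] theorem cocycle_G_d : cocycle (G i) (d j) = 0 := by simp [cocycle]
@[simp] theorem cocycle_G_h : cocycle (G i) (h j) = 0 := by simp [cocycle]
@[simp] theorem cocycle_G_Q :
    cocycle (G i) (Q j) = if i + j = 0 then -(j : ℂ) ^ 2 else 0 := by simp [cocycle]
@[simp] theorem cocycle_G_G : cocycle (G i) (G j) = 0 := by simp [cocycle]

end values

theorem cocycle_skew_gen {p q : ZMod 2} {X Y : Witt} (hX : Gen p X) (hY : Gen q Y) :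
    cocycle X Y = -(ksign p q * cocycle Y X) := by
  -- The nonzero values sit on `i + j = 0`, where skew-symmetry becomes a polynomial identity in
  -- `i`.
  have key : ∀ i j : ℤ, i + j = 0 → (j : ℂ) = -i := fun i j hs => by
    have : j = -i := by omega
    rw [this]; push_cast; ring
  cases hX with | _ i => ?_ <;> cases hY with | _ j => ?_ <;>
  · simp [ksign_00, ksign_01, ksign_10, ksign_11, add_comm j i]
    try
      by_cases hs : i + j = 0
      · simp [hs, key i j hs]
      · simp [hs]

/-- Both sides vanish unless `i + j + k = 0`. Eliminating `k` leaves polynomial identities in `i`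
and `j`, one for each choice of three kinds of generators. -/
theorem cocycle_jacobi_gen {p q r : ZMod 2} {X Y Z : Witt} (hX : Gen p X) (hY : Gen q Y)
    (hZ : Gen r Z) :
    cocycle X (bracket Y Z) =
      cocycle (bracket X Y) Z + ksign p q * cocycle Y (bracket X Z) := by
  have key : ∀ i j k : ℤ, i + (j + k) = 0 → (k : ℂ) = -i - j := fun i j k hs => by
    have : k = -i - j := by omega
    rw [this]; push_cast; ring
  cases hX with | _ i => ?_ <;> cases hY with | _ j => ?_ <;> cases hZ with | _ k => ?_ <;>
  · simp [ksign_00, ksign_01, ksign_10, ksign_11, add_assoc, add_left_comm j i]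
    try
      by_cases hs : i + (j + k) = 0
      · simp [hs, key i j k hs]
        try ring
      · simp [hs]

theorem par_induction {p : ZMod 2} {P : Witt → Prop} (gen : ∀ X, Gen p X → P X) (zero : P 0)
    (add : ∀ X Y, P X → P Y → P (X + Y)) (smul : ∀ (c : ℂ) X, P X → P (c • X)) {X : Witt}
    (hX : X ∈ par p) : P X := by
  have h := par_le_span_gen p hX
  clear hX
  induction h using Submodule.span_induction with
  | mem X h => exact gen X h
  | zero => exact zero
  | add X Y _ _ h1 h2 => exact add X Y h1 h2
  | smul c X _ h => exact smul c X h

theorem cocycle_skew {p q : ZMod 2} {X Y : Witt} (hX : X ∈ par p) (hY : Y ∈ par q) :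
    cocycle X Y = -(ksign p q * cocycle Y X) := by
  refine par_induction (P := fun X => cocycle X Y = -(ksign p q * cocycle Y X))
    (fun X hX => ?_) (by simp) (fun X X' h h' => ?_) (fun c X h => ?_) hX
  · refine par_induction (P := fun Y => cocycle X Y = -(ksign p q * cocycle Y X))
      (fun Y hY => cocycle_skew_gen hX hY) (by simp) (fun Y Y' h h' => ?_) (fun c Y h => ?_) hY
    · simp only [map_add, LinearMap.add_apply, h, h']; ring
    · simp only [map_smul, LinearMap.smul_apply, h, smul_eq_mul]; ring
  · simp only [map_add, LinearMap.add_apply, h, h']; ring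
  · simp only [map_smul, LinearMap.smul_apply, h, smul_eq_mul]; ring

theorem cocycle_jacobi {p q : ZMod 2} {X Y : Witt} (hX : X ∈ par p) (hY : Y ∈ par q) (Z : Witt) :
    cocycle X (bracket Y Z) =
      cocycle (bracket X Y) Z + ksign p q * cocycle Y (bracket X Z) := by
  refine par_induction (P := fun X => cocycle X (bracket Y Z) =
      cocycle (bracket X Y) Z + ksign p q * cocycle Y (bracket X Z))
    (fun X hX => ?_) (by simp) (fun X X' h h' => ?_) (fun c X h => ?_) hX
  · refine par_induction (P := fun Y => cocycle X (bracket Y Z) =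
      cocycle (bracket X Y) Z + ksign p q * cocycle Y (bracket X Z))
      (fun Y hY => ?_) (by simp) (fun Y Y' h h' => ?_) (fun c Y h => ?_) hY
    · have hgen : ∀ r Z, Gen r Z → cocycle X (bracket Y Z) =
          cocycle (bracket X Y) Z + ksign p q * cocycle Y (bracket X Z) :=
        fun r Z hZ => cocycle_jacobi_gen hX hY hZ
      -- The third argument enters linearly and without a sign, so it need not be homogeneous: both
      -- sides are linear maps in `Z` that agree on generators.
      exact LinearMap.congr_fun (hom_ext (φ := cocycle X ∘ₗ bracket Y)
        (ψ := cocycle (bracket X Y) + ksign p q • (cocycle Y ∘ₗ bracket X))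
        (fun i => hgen _ _ (Gen.d i)) (fun i => hgen _ _ (Gen.h i)) (fun i => hgen _ _ (Gen.Q i))
        (fun i => hgen _ _ (Gen.G i))) Z
    · simp only [map_add, LinearMap.add_apply, h, h']; ring
    · simp only [map_smul, LinearMap.smul_apply, h, smul_eq_mul]; ring
  · simp only [map_add, LinearMap.add_apply, h, h']; ring
  · simp only [map_smul, LinearMap.smul_apply, h, smul_eq_mul]; ring

theorem cocycle_even {X Y : Witt} (hX : X ∈ par 0) (hY : Y ∈ par 1) : cocycle X Y = 0 := by
  refine par_induction (P := fun X => cocycle X Y = 0)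
    (fun X hX => ?_) (by simp) (fun X X' h h' => ?_) (fun c X h => ?_) hX
  · refine par_induction (P := fun Y => cocycle X Y = 0)
      (fun Y hY => ?_) (by simp) (fun Y Y' h h' => ?_) (fun c Y h => ?_) hY
    · cases hX <;> cases hY <;> simp
    · simp [h, h']
    · simp [h]
  · simp [h, h']
  · simp [h]

end Witt

/-! ### Generators and brackets of `ℒ` -/

namespace AffineWitt

variable {g : Type u} [AddCommGroup g] [Module ℂ g]

variable (g) in
/-- The inclusion of `𝒲` into `𝒲 ⋉ (𝔤 ⊗ 𝒜)`. -/
def der : Witt →ₗ[ℂ] AffineWitt g := LinearMap.inl ℂ Witt (g ⊗[ℂ] SLaurent)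

/-- The inclusion `x ↦ x ⊗ a` of `𝔤` into `𝒲 ⋉ (𝔤 ⊗ 𝒜)`. -/
def cur (a : SLaurent) : g →ₗ[ℂ] AffineWitt g :=
  LinearMap.inr ℂ Witt (g ⊗[ℂ] SLaurent) ∘ₗ (TensorProduct.mk ℂ g SLaurent).flip a

theorem cur_apply (a : SLaurent) (x : g) : cur a x = (0, x ⊗ₜ[ℂ] a) := rfl

@[simp] theorem cur_zero : cur (0 : SLaurent) = (0 : g →ₗ[ℂ] AffineWitt g) := by simp [cur]

@[simp] theorem cur_smul (c : ℂ) (a : SLaurent) :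
    cur (c • a) = c • (cur a : g →ₗ[ℂ] AffineWitt g) := by simp [cur, LinearMap.comp_smul]

/-- It suffices to test homogeneous `x`, because `𝔤` is the sum of its even and odd parts. -/
theorem hom_ext (S : LieSuperalgebra g) {N : Type*} [AddCommGroup N] [Module ℂ N]
    {φ ψ : AffineWitt g →ₗ[ℂ] N}
    (hd : ∀ i, φ (der g (Witt.d i)) = ψ (der g (Witt.d i)))
    (hh : ∀ i, φ (der g (Witt.h i)) = ψ (der g (Witt.h i)))
    (hQ : ∀ i, φ (der g (Witt.Q i)) = ψ (der g (Witt.Q i)))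
    (hG : ∀ i, φ (der g (Witt.G i)) = ψ (der g (Witt.G i)))
    (ht : ∀ p, ∀ x ∈ S.par p, ∀ i, φ (cur (t i) x) = ψ (cur (t i) x))
    (htξ : ∀ p, ∀ x ∈ S.par p, ∀ i, φ (cur (tξ i) x) = ψ (cur (tξ i) x)) : φ = ψ := by
  have hpar : ∀ a : SLaurent, (∀ p, ∀ x ∈ S.par p, φ (cur a x) = ψ (cur a x)) →
      φ ∘ₗ cur a = ψ ∘ₗ cur a := by
    intro a h
    ext1 x
    obtain ⟨y, hy, z, hz, rfl⟩ := Submodule.mem_sup.1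
      (S.isCompl.sup_eq_top ▸ Submodule.mem_top : x ∈ S.par 0 ⊔ S.par 1)
    simp only [LinearMap.comp_apply, map_add, h 0 y hy, h 1 z hz]
  refine LinearMap.prod_ext (Witt.hom_ext hd hh hQ hG) (TensorProduct.ext' fun x a => ?_)
  refine LinearMap.congr_fun (SLaurent.hom_ext
    (φ := (φ ∘ₗ LinearMap.inr ℂ _ _) ∘ₗ TensorProduct.mk ℂ g SLaurent x)
    (ψ := (ψ ∘ₗ LinearMap.inr ℂ _ _) ∘ₗ TensorProduct.mk ℂ g SLaurent x) (fun n => ?_)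
    fun n => ?_) a
  · exact LinearMap.congr_fun (hpar (t n) fun p x hx => ht p x hx n) x
  · exact LinearMap.congr_fun (hpar (tξ n) fun p x hx => htξ p x hx n) x

/-- The linear map out of `𝒲 ⋉ (𝔤 ⊗ 𝒜)` with prescribed values on `𝒲` and on all `x ⊗ t^i`,
`x ⊗ t^i ξ`. -/
def lift {N : Type*} [AddCommGroup N] [Module ℂ N] (ρ : Witt →ₗ[ℂ] N) (u v : ℤ → g →ₗ[ℂ] N) :
    AffineWitt g →ₗ[ℂ] N :=
  LinearMap.coprod ρ (TensorProduct.lift (SLaurent.lift u v).flip)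

section lift

variable {N : Type*} [AddCommGroup N] [Module ℂ N] (ρ : Witt →ₗ[ℂ] N) (u v : ℤ → g →ₗ[ℂ] N)

@[simp] theorem lift_der (X : Witt) : lift ρ u v (der g X) = ρ X := by simp [lift, der]

@[simp] theorem lift_cur_t (i : ℤ) (x : g) : lift ρ u v (cur (t i) x) = u i x := by
  simp [lift, cur]

@[simp] theorem lift_cur_tξ (i : ℤ) (x : g) : lift ρ u v (cur (tξ i) x) = v i x := by
  simp [lift, cur]

end lift

section brackets

variable (S : LieSuperalgebra g) {x y : g} (i j : ℤ)

theorem der_mem_par {p : ZMod 2} {X : Witt} (hX : Witt.Gen p X) :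
    der g X ∈ S.affineWitt.par p :=
  ⟨hX.mem_par, Submodule.zero_mem _⟩

theorem cur_mem_par {p q r : ZMod 2} (hr : p + q = r) (hx : x ∈ S.par p) {a : SLaurent}
    (ha : a ∈ SLaurent.par q) : cur a x ∈ S.affineWitt.par r :=
  ⟨Submodule.zero_mem _, Submodule.subset_span ⟨p, q, x, a, hr, hx, ha, rfl⟩⟩

theorem cur_t_mem_par {p : ZMod 2} (hx : x ∈ S.par p) : cur (t i) x ∈ S.affineWitt.par p :=
  cur_mem_par S (add_zero p) hx (t_mem i)

theorem cur_tξ_mem_par {p : ZMod 2} (hx : x ∈ S.par p) :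
    cur (tξ i) x ∈ S.affineWitt.par (p + 1) :=
  cur_mem_par S rfl hx (tξ_mem i)

@[simp] theorem bracket_der_der (X Y : Witt) :
    S.affineWitt.bracket (der g X) (der g Y) = der g (Witt.bracket X Y) := by
  simp [LieSuperalgebra.affineWitt, LieSuperalgebra.affineWittBracket, der]

/-- The sign `(-1)^|x|` is carried by the parity involution, so the formulas derived from this one
hold for every `x`, homogeneous or not. -/
theorem bracket_der_cur_aux (X : Witt) (a : SLaurent) (x : g) :
    S.affineWitt.bracket (der g X) (cur a x) =
      cur (Witt.even X a) x + cur (Witt.odd X a) (S.parityMap x) := by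
  simp [LieSuperalgebra.affineWitt, LieSuperalgebra.affineWittBracket, der, cur_apply,
    LieSuperalgebra.evenAction, LieSuperalgebra.oddAction]

@[simp] theorem bracket_d_t : S.affineWitt.bracket (der g (Witt.d i)) (cur (t j) x) =
    (j : ℂ) • cur (t (i + j)) x := by simp [bracket_der_cur_aux]

@[simp] theorem bracket_d_tξ : S.affineWitt.bracket (der g (Witt.d i)) (cur (tξ j) x) =
    (j : ℂ) • cur (tξ (i + j)) x := by simp [bracket_der_cur_aux]

@[simp] theorem bracket_h_t : S.affineWitt.bracket (der g (Witt.h i)) (cur (t j) x) = 0 := by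
  simp [bracket_der_cur_aux]

@[simp] theorem bracket_h_tξ : S.affineWitt.bracket (der g (Witt.h i)) (cur (tξ j) x) =
    cur (tξ (i + j)) x := by simp [bracket_der_cur_aux]

@[simp] theorem bracket_Q_t : S.affineWitt.bracket (der g (Witt.Q i)) (cur (t j) x) = 0 := by
  simp [bracket_der_cur_aux]

@[simp] theorem bracket_Q_tξ : S.affineWitt.bracket (der g (Witt.Q i)) (cur (tξ j) x) =
    cur (t (i + j)) (S.parityMap x) := by simp [bracket_der_cur_aux]

@[simp] theorem bracket_G_t : S.affineWitt.bracket (der g (Witt.G i)) (cur (t j) x) =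
    (j : ℂ) • cur (tξ (i + j)) (S.parityMap x) := by simp [bracket_der_cur_aux]

@[simp] theorem bracket_G_tξ : S.affineWitt.bracket (der g (Witt.G i)) (cur (tξ j) x) = 0 := by
  simp [bracket_der_cur_aux]

theorem bracket_cur_cur_aux (a b : SLaurent) (x y : g) :
    S.affineWitt.bracket (cur a x) (cur b y) =
      cur (evenPart a * b) (S.bracket x y) + cur (oddPart a * b) (S.bracket x (S.parityMap y)) := by
  simp [LieSuperalgebra.affineWitt, LieSuperalgebra.affineWittBracket, cur_apply,
    LieSuperalgebra.loopBracket]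

@[simp] theorem bracket_t_t : S.affineWitt.bracket (cur (t i) x) (cur (t j) y) =
    cur (t (i + j)) (S.bracket x y) := by
  simp [bracket_cur_cur_aux, evenPart_of_mem (t_mem i), oddPart_of_mem (t_mem i)]

@[simp] theorem bracket_t_tξ : S.affineWitt.bracket (cur (t i) x) (cur (tξ j) y) =
    cur (tξ (i + j)) (S.bracket x y) := by
  simp [bracket_cur_cur_aux, evenPart_of_mem (t_mem i), oddPart_of_mem (t_mem i)]

@[simp] theorem bracket_tξ_t : S.affineWitt.bracket (cur (tξ i) x) (cur (t j) y) =
    cur (tξ (i + j)) (S.bracket x (S.parityMap y)) := by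
  simp [bracket_cur_cur_aux, evenPart_of_mem (tξ_mem i), oddPart_of_mem (tξ_mem i)]

@[simp] theorem bracket_tξ_tξ : S.affineWitt.bracket (cur (tξ i) x) (cur (tξ j) y) = 0 := by
  simp [bracket_cur_cur_aux, evenPart_of_mem (tξ_mem i), oddPart_of_mem (tξ_mem i)]

end brackets

variable (g) in
/-- The cocycle of `𝒲`, inflated to `𝒲 ⋉ (𝔤 ⊗ 𝒜)`. -/
def cocycle : AffineWitt g →ₗ[ℂ] AffineWitt g →ₗ[ℂ] ℂ :=
  Witt.cocycle.compl₁₂ (LinearMap.fst ℂ _ _) (LinearMap.fst ℂ _ _)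

theorem cocycle_apply (X Y : AffineWitt g) : cocycle g X Y = Witt.cocycle X.1 Y.1 := rfl

/-- The projection `ℒ → 𝒲` respects brackets and parities, so cocycles pull back along it. -/
theorem cocycle_mem_Z2 (S : LieSuperalgebra g) : cocycle g ∈ S.affineWitt.Z2 :=
  ⟨fun _ _ _ _ hx hy => Witt.cocycle_skew hx.1 hy.1,
    fun _ _ _ _ z hx hy => Witt.cocycle_jacobi hx.1 hy.1 z.1⟩

@[simp] theorem cocycle_der_der (X Y : Witt) :
    cocycle g (der g X) (der g Y) = Witt.cocycle X Y := rfl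

@[simp] theorem cocycle_cur_left (a : SLaurent) (x : g) (Y : AffineWitt g) :
    cocycle g (cur a x) Y = 0 := by simp [cocycle_apply, cur_apply]

@[simp] theorem cocycle_cur_right (a : SLaurent) (x : g) (Y : AffineWitt g) :
    cocycle g Y (cur a x) = 0 := by simp [cocycle_apply, cur_apply]

end AffineWitt

/-! ### Cocycles with coefficients in a vector space -/

namespace LieSuperalgebra

section General

variable {V : Type*} [AddCommGroup V] [Module ℂ V] {M : Type*} [AddCommGroup M] [Module ℂ M]

/-- 2-cocycles with values in a trivial module `M`. -/
structure IsCocycle (S : LieSuperalgebra V) (f : V →ₗ[ℂ] V →ₗ[ℂ] M) : Prop where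
  skew : ∀ (p q : ZMod 2) (x y : V), x ∈ S.par p → y ∈ S.par q → f x y = -(ksign p q • f y x)
  jacobi : ∀ (p q : ZMod 2) (x y z : V), x ∈ S.par p → y ∈ S.par q →
    f x (S.bracket y z) = f (S.bracket x y) z + ksign p q • f y (S.bracket x z)

variable {S : LieSuperalgebra V} {f f' : V →ₗ[ℂ] V →ₗ[ℂ] M}

theorem IsCocycle.sub (hf : S.IsCocycle f) (hf' : S.IsCocycle f') : S.IsCocycle (f - f') where
  skew p q x y hx hy := by
    simp only [LinearMap.sub_apply, hf.skew p q x y hx hy, hf'.skew p q x y hx hy, smul_sub]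
    abel
  jacobi p q x y z hx hy := by
    simp only [LinearMap.sub_apply, hf.jacobi p q x y z hx hy, hf'.jacobi p q x y z hx hy, smul_sub]
    abel

theorem IsCocycle.of_mem_Z2 {α : V →ₗ[ℂ] V →ₗ[ℂ] ℂ} (hα : α ∈ S.Z2) (k : M) :
    S.IsCocycle (α.compr₂ (LinearMap.toSpanSingleton ℂ M k)) where
  skew p q x y hx hy := by
    simp [hα.1 p q x y hx hy, smul_smul]
  jacobi p q x y z hx hy := by
    simp [hα.2 p q x y z hx hy, smul_smul, add_smul]

theorem IsCocycle.coboundary (S : LieSuperalgebra V) (ρ : V →ₗ[ℂ] M) :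
    S.IsCocycle (S.bracket.compr₂ ρ) where
  skew p q x y hx hy := by
    simp [S.skew p q x y hx hy]
  jacobi p q x y z hx hy := by
    simp [S.jacobi p q x y z hx hy]

theorem isCocycle_of_mem_Z2 {α : V →ₗ[ℂ] V →ₗ[ℂ] ℂ} (hα : α ∈ S.Z2) : S.IsCocycle α where
  skew p q x y hx hy := by simpa using hα.1 p q x y hx hy
  jacobi p q x y z hx hy := by simpa using hα.2 p q x y z hx hy

theorem exists_add_of_par (S : LieSuperalgebra V) (x : V) :
    ∃ y ∈ S.par 0, ∃ z ∈ S.par 1, y + z = x :=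
  Submodule.mem_sup.1 (S.isCompl.sup_eq_top ▸ Submodule.mem_top : x ∈ S.par 0 ⊔ S.par 1)

/-- For even `x` the sign is always `1`, so the parity of `y` plays no role. -/
theorem IsCocycle.jacobi_even (hf : S.IsCocycle f) {x : V} (hx : x ∈ S.par 0) (y z : V) :
    f x (S.bracket y z) = f (S.bracket x y) z + f y (S.bracket x z) := by
  obtain ⟨y0, h0, y1, h1, rfl⟩ := S.exists_add_of_par y
  have e0 := hf.jacobi 0 0 x y0 z hx h0
  have e1 := hf.jacobi 0 1 x y1 z hx h1
  rw [ksign_00, one_smul] at e0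
  rw [ksign_01, one_smul] at e1
  simp only [map_add, LinearMap.add_apply, e0, e1]
  abel

theorem IsCocycle.skew_even (hf : S.IsCocycle f) {x y : V} (hx : x ∈ S.par 0) {q : ZMod 2}
    (hy : y ∈ S.par q) : f x y = -f y x := by
  have h := hf.skew 0 q x y hx hy
  rwa [show ksign 0 q = 1 by simp [ksign], one_smul] at h

theorem IsCocycle.self_even (hf : S.IsCocycle f) {x : V} (hx : x ∈ S.par 0) : f x x = 0 := by
  have h := hf.skew_even hx hx
  rw [eq_neg_iff_add_eq_zero, ← two_smul ℂ] at h
  exact (smul_eq_zero.1 h).resolve_left two_ne_zero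

theorem IsCocycle.swap (hf : S.IsCocycle f) {p q : ZMod 2} {x y : V} (hx : x ∈ S.par p)
    (hy : y ∈ S.par q) (h : f y x = 0) : f x y = 0 := by
  rw [hf.skew p q x y hx hy, h, smul_zero, neg_zero]

/-- If `x` is even and in the kernel of a cocycle, then eigenvectors of `x` with nonzero total
eigenvalue are orthogonal. -/
theorem IsCocycle.eq_zero_of_eigenvalues (hf : S.IsCocycle f) {x y z : V} (hx : x ∈ S.par 0)
    (h0 : f x = 0) {a b : ℂ} (hy : S.bracket x y = a • y) (hz : S.bracket x z = b • z)
    (hab : a + b ≠ 0) : f y z = 0 := by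
  -- Evaluating the identity at `x`, `y`, `z` gives `0 = (a + b) f(y, z)`.
  have h := hf.jacobi_even hx y z
  rw [h0, hy, hz, map_smul, map_smul, LinearMap.smul_apply, ← add_smul, LinearMap.zero_apply] at h
  exact (smul_eq_zero.1 h.symm).resolve_left hab

/-- This is how perfectness of `𝔤` enters: a value that depends linearly on `x ∈ 𝔤` is computed for
`x = [y, z]`, where the cocycle identity applies. -/
theorem IsPerfect.eq_zero (hS : S.IsPerfect) {φ : V →ₗ[ℂ] M}
    (h : ∀ p q, ∀ x ∈ S.par p, ∀ y ∈ S.par q, φ (S.bracket x y) = 0) : φ = 0 := by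
  refine LinearMap.ext_on hS ?_
  rintro _ ⟨x, y, rfl⟩
  obtain ⟨x0, hx0, x1, hx1, rfl⟩ := S.exists_add_of_par x
  obtain ⟨y0, hy0, y1, hy1, rfl⟩ := S.exists_add_of_par y
  simp only [map_add, LinearMap.add_apply, h 0 0 x0 hx0 y0 hy0, h 0 1 x0 hx0 y1 hy1,
    h 1 0 x1 hx1 y0 hy0, h 1 1 x1 hx1 y1 hy1, add_zero, LinearMap.zero_apply]

theorem parityMap_parityMap (S : LieSuperalgebra V) (x : V) :
    S.parityMap (S.parityMap x) = x := by
  obtain ⟨y, hy, z, hz, rfl⟩ := S.exists_add_of_par x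
  simp [S.parityMap_of_mem hy, S.parityMap_of_mem hz, ksign_10, ksign_11]

end General

end LieSuperalgebra

/-! ### Normalized cocycles on `ℒ` vanish -/

namespace AffineWitt

variable {g : Type u} [AddCommGroup g] [Module ℂ g] {S : LieSuperalgebra g}
  {M : Type*} [AddCommGroup M] [Module ℂ M]

/-- Homogeneous generators of `𝒲 ⋉ (𝔤 ⊗ 𝒜)`, with their parity and their eigenvalues under `d_0`
and `h_0`. -/
inductive Gen (S : LieSuperalgebra g) : ZMod 2 → ℤ → ℤ → AffineWitt g → Prop
  | d (i : ℤ) : Gen S 0 i 0 (der g (Witt.d i))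
  | h (i : ℤ) : Gen S 0 i 0 (der g (Witt.h i))
  | Q (i : ℤ) : Gen S 1 i (-1) (der g (Witt.Q i))
  | G (i : ℤ) : Gen S 1 i 1 (der g (Witt.G i))
  | t (i : ℤ) (p : ZMod 2) (x : g) (hx : x ∈ S.par p) : Gen S p i 0 (cur (t i) x)
  | tξ (i : ℤ) (p : ZMod 2) (x : g) (hx : x ∈ S.par p) : Gen S (p + 1) i 1 (cur (tξ i) x)

theorem Gen.mem_par {p : ZMod 2} {i c : ℤ} {X : AffineWitt g} (hX : Gen S p i c X) :
    X ∈ S.affineWitt.par p := by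
  cases hX with
  | d => exact der_mem_par S (Witt.Gen.d _)
  | h => exact der_mem_par S (Witt.Gen.h _)
  | Q => exact der_mem_par S (Witt.Gen.Q _)
  | G => exact der_mem_par S (Witt.Gen.G _)
  | t _ _ _ hx => exact cur_t_mem_par S _ hx
  | tξ _ _ _ hx => exact cur_tξ_mem_par S _ hx

theorem Gen.bracket_d_zero {p : ZMod 2} {i c : ℤ} {X : AffineWitt g} (hX : Gen S p i c X) :
    S.affineWitt.bracket (der g (Witt.d 0)) X = (i : ℂ) • X := by
  cases hX <;> simp

theorem Gen.bracket_h_zero {p : ZMod 2} {i c : ℤ} {X : AffineWitt g} (hX : Gen S p i c X) :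
    S.affineWitt.bracket (der g (Witt.h 0)) X = (c : ℂ) • X := by
  cases hX <;> simp

theorem hom_ext_gen {N : Type*} [AddCommGroup N] [Module ℂ N] {φ ψ : AffineWitt g →ₗ[ℂ] N}
    (h : ∀ p i c X, Gen S p i c X → φ X = ψ X) : φ = ψ :=
  hom_ext S (fun i => h _ _ _ _ (Gen.d i)) (fun i => h _ _ _ _ (Gen.h i))
    (fun i => h _ _ _ _ (Gen.Q i)) (fun i => h _ _ _ _ (Gen.G i))
    (fun p x hx i => h _ _ _ _ (Gen.t i p x hx)) (fun p x hx i => h _ _ _ _ (Gen.tξ i p x hx))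

/-- The conditions that single out a representative of a cohomology class. -/
structure IsNormalized (f : AffineWitt g →ₗ[ℂ] AffineWitt g →ₗ[ℂ] M) : Prop where
  d_d : ∀ j, j ≠ 0 → f (der g (Witt.d 0)) (der g (Witt.d j)) = 0
  d_h : ∀ j, j ≠ 0 → f (der g (Witt.d 0)) (der g (Witt.h j)) = 0
  d_Q : ∀ j, j ≠ 0 → f (der g (Witt.d 0)) (der g (Witt.Q j)) = 0
  d_G : ∀ j, j ≠ 0 → f (der g (Witt.d 0)) (der g (Witt.G j)) = 0
  d_t : ∀ j, j ≠ 0 → ∀ x, f (der g (Witt.d 0)) (cur (t j) x) = 0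
  d_tξ : ∀ j, j ≠ 0 → ∀ x, f (der g (Witt.d 0)) (cur (tξ j) x) = 0
  h_Q : f (der g (Witt.h 0)) (der g (Witt.Q 0)) = 0
  h_G : f (der g (Witt.h 0)) (der g (Witt.G 0)) = 0
  h_tξ : ∀ x, f (der g (Witt.h 0)) (cur (tξ 0) x) = 0
  Q_G : f (der g (Witt.Q 0)) (der g (Witt.G 0)) = 0
  Q_tξ : ∀ x, f (der g (Witt.Q 0)) (cur (tξ 0) x) = 0
  d_h_one : f (der g (Witt.d 1)) (der g (Witt.h (-1))) = 0
  h_h_one : f (der g (Witt.h 1)) (der g (Witt.h (-1))) = 0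

section normalized

variable {f : AffineWitt g →ₗ[ℂ] AffineWitt g →ₗ[ℂ] M}

/-- Since `d_0 = [Q_0, G_0]` and `h_0` scales `Q_0` and `G_0`, the cocycle identity expresses the
value through `f(Q_0, G_0)`, which is normalized to zero. -/
theorem h_zero_d_zero (hf : S.affineWitt.IsCocycle f) (hn : IsNormalized f) :
    f (der g (Witt.h 0)) (der g (Witt.d 0)) = 0 := by
  have e := hf.jacobi_even (Gen.h (S := S) 0).mem_par (der g (Witt.Q 0)) (der g (Witt.G 0))
  simpa [hn.Q_G] using e

/-- Nonzero degrees are covered by the normalization. Degree-zero elements commute with `d_0`, so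
`f(d_0, ·)` vanishes on their brackets. Up to sign, `Q_0`, `G_0` and `x ⊗ ξ` are brackets with
`h_0`, and `x ⊗ 1` is a sum of brackets because `𝔤` is perfect. The elements `d_0` and `h_0`
themselves are handled by skew-symmetry and `h_zero_d_zero`. -/
theorem apply_d_zero (hS : S.IsPerfect) (hf : S.affineWitt.IsCocycle f)
    (hn : IsNormalized f) : f (der g (Witt.d 0)) = 0 := by
  have hd := (Gen.d (S := S) 0).mem_par
  have hh := (Gen.h (S := S) 0).mem_par
  refine hom_ext S (fun i => ?_) (fun i => ?_) (fun i => ?_) (fun i => ?_) (fun p x hx i => ?_)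
    (fun p x hx i => ?_) <;> rw [LinearMap.zero_apply] <;> rcases eq_or_ne i 0 with rfl | hi
  · exact hf.self_even hd
  · exact hn.d_d i hi
  · exact hf.swap hd hh (h_zero_d_zero hf hn)
  · exact hn.d_h i hi
  · simpa [hn.h_Q] using hf.jacobi_even hd (der g (Witt.h 0)) (der g (Witt.Q 0))
  · exact hn.d_Q i hi
  · simpa [hn.h_G] using hf.jacobi_even hd (der g (Witt.h 0)) (der g (Witt.G 0))
  · exact hn.d_G i hi
  · refine LinearMap.congr_fun (hS.eq_zero (φ := f (der g (Witt.d 0)) ∘ₗ cur (t 0))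
      fun p q y _ z _ => ?_) x
    simpa using hf.jacobi_even hd (cur (t 0) y) (cur (t 0) z)
  · exact hn.d_t i hi x
  · simpa [hn.h_tξ] using hf.jacobi_even hd (der g (Witt.h 0)) (cur (tξ 0) x)
  · exact hn.d_tξ i hi x

theorem eq_zero_of_degree (hS : S.IsPerfect) (hf : S.affineWitt.IsCocycle f)
    (hn : IsNormalized f) {p q : ZMod 2} {i j c e : ℤ} {X Y : AffineWitt g} (hX : Gen S p i c X)
    (hY : Gen S q j e Y) (hij : i + j ≠ 0) : f X Y = 0 :=
  hf.eq_zero_of_eigenvalues (Gen.d (S := S) 0).mem_par (apply_d_zero hS hf hn) hX.bracket_d_zero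
    hY.bracket_d_zero (by exact_mod_cast hij)

/-- Only degree zero is left by `eq_zero_of_degree`. There the normalization covers the charged
generators, and perfectness covers `x ⊗ 1`, which commutes with `h_0`. -/
theorem apply_h_zero (hS : S.IsPerfect) (hf : S.affineWitt.IsCocycle f)
    (hn : IsNormalized f) : f (der g (Witt.h 0)) = 0 := by
  have hh := (Gen.h (S := S) 0).mem_par
  refine hom_ext_gen (S := S) fun q i c X hX => ?_
  rw [LinearMap.zero_apply]
  rcases eq_or_ne i 0 with rfl | hi
  · cases hX with
    | d => exact h_zero_d_zero hf hn
    | h => exact hf.self_even hh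
    | Q => exact hn.h_Q
    | G => exact hn.h_G
    | t _ _ x hx =>
      refine LinearMap.congr_fun (hS.eq_zero (φ := f (der g (Witt.h 0)) ∘ₗ cur (t 0))
        fun p q y _ z _ => ?_) x
      simpa using hf.jacobi_even hh (cur (t 0) y) (cur (t 0) z)
    | tξ => exact hn.h_tξ _
  · exact eq_zero_of_degree hS hf hn (Gen.h 0) hX (by simpa using hi)

theorem eq_zero_of_charge (hS : S.IsPerfect) (hf : S.affineWitt.IsCocycle f)
    (hn : IsNormalized f) {p q : ZMod 2} {i j c e : ℤ} {X Y : AffineWitt g} (hX : Gen S p i c X)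
    (hY : Gen S q j e Y) (hce : c + e ≠ 0) : f X Y = 0 :=
  hf.eq_zero_of_eigenvalues (Gen.h (S := S) 0).mem_par (apply_h_zero hS hf hn) hX.bracket_h_zero
    hY.bracket_h_zero (by exact_mod_cast hce)

/-- This excludes central terms of affine type. Apply the cocycle identity to `Q_0`, `x ⊗ t^i ξ` and
`y ⊗ t^j`: as `Q_0` kills `y ⊗ t^j`, the value equals one of `f(Q_0, ·)` on `𝔤 ⊗ t^{i+j} ξ`, which
is normalized to zero when `i + j = 0`. -/
theorem apply_t_t (hS : S.IsPerfect) (hf : S.affineWitt.IsCocycle f)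
    (hn : IsNormalized f) {p q : ZMod 2} {x y : g}
    (hx : x ∈ S.par p) (hy : y ∈ S.par q) (i j : ℤ) :
    f (cur (t i) x) (cur (t j) y) = 0 := by
  by_cases hij : i + j = 0
  · have hx' : S.parityMap x ∈ S.par p := by
      rw [S.parityMap_of_mem hx]; exact Submodule.smul_mem _ _ hx
    -- The bracket with `Q_0` applies the parity involution, so `x` is twisted beforehand to obtain
    -- `x ⊗ t^i` itself.
    have e := hf.jacobi 1 (p + 1) (der g (Witt.Q 0)) (cur (tξ i) (S.parityMap x)) (cur (t j) y)
      (Gen.Q 0).mem_par (Gen.tξ i p _ hx').mem_par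
    simpa [hij, hn.Q_tξ, S.parityMap_parityMap] using e.symm
  · exact eq_zero_of_degree hS hf hn (Gen.t i p x hx) (Gen.t j q y hy) hij

/-- For `x = [y, z]`, write `x ⊗ t^{-i} ξ` as a bracket of `y ⊗ t^{-i} ξ` with a twisted `z ⊗ 1`. As
`Q_i` kills `𝔤 ⊗ 1`, only a value covered by `apply_t_t` remains. -/
theorem apply_Q_tξ (hS : S.IsPerfect) (hf : S.affineWitt.IsCocycle f)
    (hn : IsNormalized f) (i : ℤ) (x : g) :
    f (der g (Witt.Q i)) (cur (tξ (-i)) x) = 0 := by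
  refine LinearMap.congr_fun (hS.eq_zero (φ := f (der g (Witt.Q i)) ∘ₗ cur (tξ (-i)))
    fun p q y hy z hz => ?_) x
  have hz' : S.parityMap z ∈ S.par q := by
    rw [S.parityMap_of_mem hz]; exact Submodule.smul_mem _ _ hz
  have hy' : S.parityMap y ∈ S.par p := by
    rw [S.parityMap_of_mem hy]; exact Submodule.smul_mem _ _ hy
  have e := hf.jacobi 1 (p + 1) (der g (Witt.Q i)) (cur (tξ (-i)) y) (cur (t 0) (S.parityMap z))
    (Gen.Q i).mem_par (Gen.tξ (-i) p _ hy).mem_par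
  simpa [S.parityMap_parityMap, apply_t_t hS hf hn hy' hz'] using e

/-- The factor `z ⊗ 1` in `[y, z] ⊗ t^{-i} = [y ⊗ t^{-i}, z ⊗ 1]` is killed by `d_i`, so `apply_t_t`
finishes. -/
theorem apply_d_t (hS : S.IsPerfect) (hf : S.affineWitt.IsCocycle f)
    (hn : IsNormalized f) (i : ℤ) (x : g) :
    f (der g (Witt.d i)) (cur (t (-i)) x) = 0 := by
  refine LinearMap.congr_fun (hS.eq_zero (φ := f (der g (Witt.d i)) ∘ₗ cur (t (-i)))
    fun p q y hy z hz => ?_) x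
  have e := hf.jacobi_even (Gen.d (S := S) i).mem_par (cur (t (-i)) y) (cur (t 0) z)
  simpa [apply_t_t hS hf hn hy hz] using e

/-- Here `h_i` kills both factors of `[y ⊗ t^{-i}, z ⊗ 1]`. -/
theorem apply_h_t (hS : S.IsPerfect) (hf : S.affineWitt.IsCocycle f) (i : ℤ) (x : g) :
    f (der g (Witt.h i)) (cur (t (-i)) x) = 0 := by
  refine LinearMap.congr_fun (hS.eq_zero (φ := f (der g (Witt.h i)) ∘ₗ cur (t (-i)))
    fun p q y hy z hz => ?_) x
  have e := hf.jacobi_even (Gen.h (S := S) i).mem_par (cur (t (-i)) y) (cur (t 0) z)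
  simpa using e

/-- The cocycle identity for `h_i`, `Q_j`, `G_{-(i+j)}`. With `a(i) = f(h_i, d_{-i})`, `b(i) =
f(h_i, h_{-i})` and `q(i) = f(Q_i, G_{-i})`, it reads `a(i) + j b(i) = q(j) - q(i + j)`, and it
determines all three functions from few values. -/
theorem apply_h_d_add (hf : S.affineWitt.IsCocycle f) (i j : ℤ) :
    f (der g (Witt.h i)) (der g (Witt.d (-i))) +
        (j : ℂ) • f (der g (Witt.h i)) (der g (Witt.h (-i))) =
      -f (der g (Witt.Q (i + j))) (der g (Witt.G (-(i + j)))) +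
        f (der g (Witt.Q j)) (der g (Witt.G (-j))) := by
  have e := hf.jacobi_even (Gen.h (S := S) i).mem_par (der g (Witt.Q j)) (der g (Witt.G (-(i + j))))
  simpa [show j + (-j + -i) = -i by ring, show i + (-j + -i) = -j by ring] using e

theorem apply_h_d (hf : S.affineWitt.IsCocycle f) (hn : IsNormalized f) (i : ℤ) :
    f (der g (Witt.h i)) (der g (Witt.d (-i))) =
      -f (der g (Witt.Q i)) (der g (Witt.G (-i))) := by
  simpa [hn.Q_G] using apply_h_d_add hf i 0

/-- In the notation above, `a = -q`. The pair `(1, i)` with `b(1) = 0` gives `q(i + 1) = q(1) +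
q(i)`; inserting this in the equation for `(i, 1)` leaves `b(i) = 0`. -/
theorem apply_h_h (hf : S.affineWitt.IsCocycle f) (hn : IsNormalized f) (i : ℤ) :
    f (der g (Witt.h i)) (der g (Witt.h (-i))) = 0 := by
  have e1 := apply_h_d_add hf i 1
  have e2 := apply_h_d_add hf 1 i
  rw [apply_h_d hf hn] at e1 e2
  rw [hn.h_h_one, smul_zero, add_zero, add_comm 1 i] at e2
  rw [Int.cast_one, one_smul] at e1
  have e3 : f (der g (Witt.Q (i + 1))) (der g (Witt.G (-(i + 1)))) =
      f (der g (Witt.Q 1)) (der g (Witt.G (-1))) + f (der g (Witt.Q i)) (der g (Witt.G (-i))) := by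
    rw [← sub_eq_zero, ← sub_eq_zero.2 e2]; abel
  rw [e3] at e1
  rw [← sub_eq_zero.2 e1]; abel

/-- Once `b = 0`, the functional equation says that `q` is additive, so `q(-1) = 0` suffices. This
is the normalization of `f(d_1, h_{-1})`, because `a(-1) = -q(-1)`. -/
theorem apply_Q_G (hf : S.affineWitt.IsCocycle f) (hn : IsNormalized f) (i : ℤ) :
    f (der g (Witt.Q i)) (der g (Witt.G (-i))) = 0 := by
  have hadd : ∀ i j : ℤ, f (der g (Witt.Q (i + j))) (der g (Witt.G (-(i + j)))) =
      f (der g (Witt.Q i)) (der g (Witt.G (-i))) + f (der g (Witt.Q j)) (der g (Witt.G (-j))) := by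
    intro i j
    have e := apply_h_d_add hf i j
    rw [apply_h_h hf hn, apply_h_d hf hn, smul_zero, add_zero] at e
    rw [← sub_eq_zero, ← sub_eq_zero.2 e]; abel
  have hneg : f (der g (Witt.Q (-1))) (der g (Witt.G (- -1))) = 0 := by
    rw [← neg_eq_zero, ← apply_h_d hf hn, neg_neg]
    exact hf.swap (Gen.h (S := S) _).mem_par (Gen.d (S := S) _).mem_par hn.d_h_one
  have hone : f (der g (Witt.Q 1)) (der g (Witt.G (-1))) = 0 := by
    have e := hadd 1 (-1)
    rw [hneg, add_zero, add_neg_cancel, neg_zero, hn.Q_G] at e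
    exact e.symm
  induction i with
  | zero => exact hn.Q_G
  | succ n ih => rw [hadd, ih, hone, add_zero]
  | pred n ih => rw [sub_eq_add_neg, hadd, ih, hneg, add_zero]

theorem apply_d_h (hf : S.affineWitt.IsCocycle f) (hn : IsNormalized f) (i : ℤ) :
    f (der g (Witt.d i)) (der g (Witt.h (-i))) = 0 := by
  refine hf.swap (Gen.d (S := S) _).mem_par (Gen.h (S := S) _).mem_par ?_
  have e := apply_h_d hf hn (-i)
  rwa [apply_Q_G hf hn, neg_zero, neg_neg] at e

/-- Here `d_{-i} = [Q_0, G_{-i}]` and `d_i` commutes with `Q_0`, so the value is a multiple of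
`f(Q_0, G_0)`. In this way the Virasoro term is absorbed. -/
theorem apply_d_d (hf : S.affineWitt.IsCocycle f) (hn : IsNormalized f) (i : ℤ) :
    f (der g (Witt.d i)) (der g (Witt.d (-i))) = 0 := by
  have e := hf.jacobi_even (Gen.d (S := S) i).mem_par (der g (Witt.Q 0)) (der g (Witt.G (-i)))
  simpa [hn.Q_G] using e

/-- A normalized cocycle vanishes. -/
theorem eq_zero_of_isNormalized (hS : S.IsPerfect) (hf : S.affineWitt.IsCocycle f)
    (hn : IsNormalized f) : f = 0 := by
  have hd := apply_d_d hf hn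
  have hQ := apply_Q_G hf hn
  have hh : ∀ i, f (der g (Witt.h i)) (der g (Witt.d (-i))) = 0 := fun i => by
    rw [apply_h_d hf hn, hQ, neg_zero]
  refine hom_ext_gen (S := S) fun p i c X hX => hom_ext_gen (S := S) fun q j e Y hY => ?_
  rw [LinearMap.zero_apply, LinearMap.zero_apply]
  by_cases hij : i + j = 0
  swap
  · exact eq_zero_of_degree hS hf hn hX hY hij
  by_cases hce : c + e = 0
  swap
  · exact eq_zero_of_charge hS hf hn hX hY hce
  obtain rfl : j = -i := by omega
  have hpX := hX.mem_par
  have hpY := hY.mem_par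
  -- Total charge zero leaves two kinds of pairs: two elements among `d`, `h`, `x ⊗ t^i`, or a `Q`
  -- with a `G` or an `x ⊗ t^i ξ`.
  cases hX with
  | d =>
    cases hY with
    | d => exact hd i
    | h => exact apply_d_h hf hn i
    | t => exact apply_d_t hS hf hn i _
    | _ => simp at hce
  | h =>
    cases hY with
    | d => exact hh i
    | h => exact apply_h_h hf hn i
    | t => exact apply_h_t hS hf i _
    | _ => simp at hce
  | Q =>
    cases hY with
    | G => exact hQ i
    | tξ => exact apply_Q_tξ hS hf hn i _
    | _ => simp at hce
  | G =>
    cases hY with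
    | Q => exact hf.swap hpX hpY (by simpa using hQ (-i))
    | _ => simp at hce
  | t _ _ x hx =>
    cases hY with
    | d => exact hf.swap hpX hpY (by simpa using apply_d_t hS hf hn (-i) x)
    | h => exact hf.swap hpX hpY (by simpa using apply_h_t hS hf (-i) x)
    | t _ _ y hy => exact apply_t_t hS hf hn hx hy _ _
    | _ => simp at hce
  | tξ _ _ x hx =>
    cases hY with
    | Q => exact hf.swap hpX hpY (by simpa using apply_Q_tξ hS hf hn (-i) x)
    | _ => simp at hce

end normalized

/-- Every cocycle is a multiple of the standard one, up to a coboundary. -/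
theorem exists_eq_cocycle_add_coboundary (hS : S.IsPerfect)
    {f : AffineWitt g →ₗ[ℂ] AffineWitt g →ₗ[ℂ] M} (hf : S.affineWitt.IsCocycle f) :
    ∃ (k : M) (ρ : AffineWitt g →ₗ[ℂ] M), ∀ X Y,
      f X Y = cocycle g X Y • k + ρ (S.affineWitt.bracket X Y) := by
  -- The explicit cocycle has value `2` at `(h_1, h_{-1})`, and coboundaries vanish there, so `k` is
  -- forced.
  set k : M := (2 : ℂ)⁻¹ • f (der g (Witt.h 1)) (der g (Witt.h (-1))) with hk
  set ρ : AffineWitt g →ₗ[ℂ] M := lift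
    (Witt.lift
      -- For `j ≠ 0` the relation `[d_0, X] = j X` forces `ρ(X) = j⁻¹ f(d_0, X)`. For `j = 0` the
      -- values come from `[Q_0, G_0] = d_0`, `[d_1, h_{-1}] = -h_0`, `[h_0, Q_0] = -Q_0` and `[h_0,
      -- G_0] = G_0`. The term `-k` in `ρ(h_0)` compensates for the value `-1` of the explicit
      -- cocycle at `(d_1, h_{-1})`.
      (fun j => if j = 0 then f (der g (Witt.Q 0)) (der g (Witt.G 0))
        else (j : ℂ)⁻¹ • f (der g (Witt.d 0)) (der g (Witt.d j)))
      (fun j => if j = 0 then -k - f (der g (Witt.d 1)) (der g (Witt.h (-1)))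
        else (j : ℂ)⁻¹ • f (der g (Witt.d 0)) (der g (Witt.h j)))
      (fun j => if j = 0 then -f (der g (Witt.h 0)) (der g (Witt.Q 0))
        else (j : ℂ)⁻¹ • f (der g (Witt.d 0)) (der g (Witt.Q j)))
      (fun j => if j = 0 then f (der g (Witt.h 0)) (der g (Witt.G 0))
        else (j : ℂ)⁻¹ • f (der g (Witt.d 0)) (der g (Witt.G j))))
    -- On `𝔤 ⊗ 1` and `𝔤 ⊗ ξ` the values come from the brackets of `x ⊗ ξ` with `Q_0` and with
    -- `h_0`; the former twists `x` by the parity involution, which is its own inverse.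
    (fun j => if j = 0 then f (der g (Witt.Q 0)) ∘ₗ cur (tξ 0) ∘ₗ S.parityMap
      else (j : ℂ)⁻¹ • (f (der g (Witt.d 0)) ∘ₗ cur (t j)))
    (fun j => if j = 0 then f (der g (Witt.h 0)) ∘ₗ cur (tξ 0)
      else (j : ℂ)⁻¹ • (f (der g (Witt.d 0)) ∘ₗ cur (tξ j))) with hρ
  refine ⟨k, ρ, fun X Y => ?_⟩
  have hf' := (hf.sub (LieSuperalgebra.IsCocycle.of_mem_Z2 (cocycle_mem_Z2 S) k)).sub
    (LieSuperalgebra.IsCocycle.coboundary S.affineWitt ρ)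
  have h0 := eq_zero_of_isNormalized hS hf' ?_
  · have e := LinearMap.congr_fun₂ h0 X Y
    simp only [LinearMap.sub_apply, LinearMap.compr₂_apply, LinearMap.toSpanSingleton_apply,
      LinearMap.zero_apply, sub_sub, sub_eq_zero] at e
    exact e
  · constructor
    case d_h_one => simp [hρ]
    case h_h_one => simp [hk, smul_smul]
    all_goals
      intros
      simp [*, smul_smul, S.parityMap_parityMap]

end AffineWitt

/-! ### Sections of central extensions and a criterion for universality -/

namespace LieSuperalgebra

section Universal

variable {V : Type u} [AddCommGroup V] [Module ℂ V] {SV : LieSuperalgebra V}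
  {F : Type v} [AddCommGroup F] [Module ℂ F] {SF : LieSuperalgebra F} {ι : F →ₗ[ℂ] V}

theorem projection_mem_par (S : LieSuperalgebra V) (x : V) :
    Submodule.projection (S.par 0) (S.par 1) S.isCompl x ∈ S.par 0 ∧
      Submodule.projection (S.par 1) (S.par 0) S.isCompl.symm x ∈ S.par 1 :=
  ⟨Submodule.projection_apply_mem _ _, Submodule.projection_apply_mem _ _⟩

theorem eq_zero_of_mem_par {S : LieSuperalgebra V} {x : V} (h0 : x ∈ S.par 0) (h1 : x ∈ S.par 1) :
    x = 0 :=
  Submodule.disjoint_def.1 S.isCompl.disjoint x h0 h1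

theorem IsCentralExtension.bracket_ker (h : IsCentralExtension SF SV ι) {c : F}
    (hc : c ∈ LinearMap.ker ι) (x : F) : SF.bracket x c = 0 := by
  obtain ⟨y, hy, z, hz, rfl⟩ := SF.exists_add_of_par x
  have hc0 := h.ker_even hc
  rw [map_add, LinearMap.add_apply, SF.skew 0 0 y c hy hc0, SF.skew 1 0 z c hz hc0,
    h.ker_central c hc, h.ker_central c hc]
  simp

theorem IsCentralExtension.exists_section (h : IsCentralExtension SF SV ι) :
    ∃ s : V →ₗ[ℂ] F, (∀ p, ∀ x ∈ SV.par p, s x ∈ SF.par p) ∧ ∀ x, ι (s x) = x := by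
  obtain ⟨s, hs⟩ := LinearMap.exists_rightInverse_of_surjective ι
    (LinearMap.range_eq_top.2 h.surjective)
  have hs' : ∀ x, ι (s x) = x := fun x => LinearMap.congr_fun hs x
  let p0 := Submodule.projection (SV.par 0) (SV.par 1) SV.isCompl
  let p1 := Submodule.projection (SV.par 1) (SV.par 0) SV.isCompl.symm
  let q0 := Submodule.projection (SF.par 0) (SF.par 1) SF.isCompl
  let q1 := Submodule.projection (SF.par 1) (SF.par 0) SF.isCompl.symm
  have hp : ∀ x, p0 x + p1 x = x := fun x =>
    Submodule.projection_add_projection_eq_self SV.isCompl x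
  have hq : ∀ x, q0 x + q1 x = x := fun x =>
    Submodule.projection_add_projection_eq_self SF.isCompl x
  have h0 : ∀ x ∈ SV.par 0, ι (q0 (s x)) = x := by
    intro x hx
    have e : ι (q0 (s x)) + ι (q1 (s x)) = x := by rw [← map_add, hq, hs']
    have m0 := h.isHom.map_par 0 _ (SF.projection_mem_par (s x)).1
    have m1 := h.isHom.map_par 1 _ (SF.projection_mem_par (s x)).2
    -- This vector is odd, and it is even as the difference of `x` and the even vector `ι (q0 (s
    -- x))`.
    have e1 : ι (q1 (s x)) = 0 := by
      refine eq_zero_of_mem_par (S := SV) ?_ m1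
      rw [← eq_sub_iff_add_eq'] at e
      rw [e]; exact Submodule.sub_mem _ hx m0
    rwa [e1, add_zero] at e
  have h1 : ∀ x ∈ SV.par 1, ι (q1 (s x)) = x := by
    intro x hx
    have e : ι (q0 (s x)) + ι (q1 (s x)) = x := by rw [← map_add, hq, hs']
    have m0 := h.isHom.map_par 0 _ (SF.projection_mem_par (s x)).1
    have m1 := h.isHom.map_par 1 _ (SF.projection_mem_par (s x)).2
    have e1 : ι (q0 (s x)) = 0 := by
      refine eq_zero_of_mem_par (S := SV) m0 ?_
      rw [← eq_sub_iff_add_eq] at e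
      rw [e]; exact Submodule.sub_mem _ hx m1
    rwa [e1, zero_add] at e
  -- The parity-preserving part of an arbitrary linear section is again a section.
  refine ⟨q0 ∘ₗ s ∘ₗ p0 + q1 ∘ₗ s ∘ₗ p1, fun p x hx => ?_, fun x => ?_⟩
  · rcases zmod2_cases p with rfl | rfl
    · have e : p1 x = 0 := (Submodule.projection_apply_eq_zero_iff SV.isCompl.symm).2 hx
      simp only [LinearMap.add_apply, LinearMap.comp_apply, e, map_zero, add_zero, zero_add]
      exact (SF.projection_mem_par _).1
    · have e : p0 x = 0 := (Submodule.projection_apply_eq_zero_iff SV.isCompl).2 hx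
      simp only [LinearMap.add_apply, LinearMap.comp_apply, e, map_zero, add_zero, zero_add]
      exact (SF.projection_mem_par _).2
  · simp only [LinearMap.add_apply, LinearMap.comp_apply, map_add]
    rw [h0 _ (SV.projection_mem_par x).1, h1 _ (SV.projection_mem_par x).2, hp]

/-- The cocycle of a section of a central extension. -/
def sectionCocycle (h : IsCentralExtension SF SV ι) (s : V →ₗ[ℂ] F) (hs : ∀ x, ι (s x) = x) :
    V →ₗ[ℂ] V →ₗ[ℂ] LinearMap.ker ι :=
  LinearMap.mk₂ ℂ (fun x y => ⟨SF.bracket (s x) (s y) - s (SV.bracket x y), by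
      rw [LinearMap.mem_ker, map_sub, h.isHom.map_bracket, hs, hs, hs, sub_self]⟩)
    (fun x y z => Subtype.ext (by simp; abel))
    (fun c x y => Subtype.ext (by simp [smul_sub]))
    (fun x y z => Subtype.ext (by simp; abel))
    (fun c x y => Subtype.ext (by simp [smul_sub]))

theorem coe_sectionCocycle (h : IsCentralExtension SF SV ι) (s : V →ₗ[ℂ] F)
    (hs : ∀ x, ι (s x) = x) (x y : V) :
    (sectionCocycle h s hs x y : F) = SF.bracket (s x) (s y) - s (SV.bracket x y) := rfl

theorem isCocycle_sectionCocycle (h : IsCentralExtension SF SV ι) {s : V →ₗ[ℂ] F}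
    (hs : ∀ x, ι (s x) = x) (hpar : ∀ p, ∀ x ∈ SV.par p, s x ∈ SF.par p) :
    SV.IsCocycle (sectionCocycle h s hs) where
  skew p q x y hx hy := Subtype.ext <| by
    simp only [Submodule.coe_neg, Submodule.coe_smul, coe_sectionCocycle,
      SF.skew p q _ _ (hpar p x hx) (hpar q y hy), SV.skew p q x y hx hy, map_neg, map_smul,
      smul_sub]
    abel
  jacobi p q x y z hx hy := Subtype.ext <| by
    have e : ∀ x y, s (SV.bracket x y) =
        SF.bracket (s x) (s y) - (sectionCocycle h s hs x y : F) := fun x y => by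
      rw [coe_sectionCocycle]; abel
    simp only [Submodule.coe_add, Submodule.coe_smul, coe_sectionCocycle]
    -- The section respects brackets up to central elements, which disappear inside a further
    -- bracket. What remains is the difference of the Jacobi identities of the two algebras.
    have e1 : SF.bracket (s x) (s (SV.bracket y z)) =
        SF.bracket (s x) (SF.bracket (s y) (s z)) := by
      rw [e y z, map_sub, h.bracket_ker (Subtype.prop _), sub_zero]
    have e2 : SF.bracket (s y) (s (SV.bracket x z)) =
        SF.bracket (s y) (SF.bracket (s x) (s z)) := by
      rw [e x z, map_sub, h.bracket_ker (Subtype.prop _), sub_zero]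
    have e3 : SF.bracket (s (SV.bracket x y)) (s z) =
        SF.bracket (SF.bracket (s x) (s y)) (s z) := by
      rw [e x y, map_sub, LinearMap.sub_apply, h.ker_central _ (Subtype.prop _), sub_zero]
    rw [e1, e2, e3, SF.jacobi p q _ _ _ (hpar p x hx) (hpar q y hy), SV.jacobi p q x y z hx hy,
      map_add, map_smul, smul_sub]
    abel

/-- Homomorphisms over `V` from a perfect Lie superalgebra to a central extension are unique. -/
theorem IsCentralExtension.hom_unique (h : IsCentralExtension SF SV ι) {E : Type w}
    [AddCommGroup E] [Module ℂ E] {SE : LieSuperalgebra E} (hE : SE.IsPerfect) {τ : E →ₗ[ℂ] V}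
    {ψ φ : E →ₗ[ℂ] F} (hψ : IsHom SE SF ψ ∧ ι ∘ₗ ψ = τ) (hφ : IsHom SE SF φ ∧ ι ∘ₗ φ = τ) :
    ψ = φ := by
  refine LinearMap.ext_on hE ?_
  rintro _ ⟨X, Y, rfl⟩
  -- The two homomorphisms differ by central elements, so they agree on brackets, and these span.
  have hker : ∀ Z, ψ Z - φ Z ∈ LinearMap.ker ι := fun Z => by
    have e := LinearMap.congr_fun (hψ.2.trans hφ.2.symm) Z
    rw [LinearMap.mem_ker, map_sub, sub_eq_zero]
    exact e
  have e1 : SF.bracket (ψ X) (ψ Y) = SF.bracket (φ X) (ψ Y) := by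
    rw [← sub_eq_zero, ← LinearMap.sub_apply, ← map_sub]
    exact h.ker_central _ (hker X) _
  have e2 : SF.bracket (φ X) (ψ Y) = SF.bracket (φ X) (φ Y) := by
    rw [← sub_eq_zero, ← map_sub]
    exact h.bracket_ker (hker Y) _
  rw [hψ.1.map_bracket, hφ.1.map_bracket, e1, e2]

theorem centralExtension_bracket {S : LieSuperalgebra V} {α : V →ₗ[ℂ] V →ₗ[ℂ] ℂ} (hα : α ∈ S.Z2)
    (heven : ∀ x ∈ S.par 0, ∀ y ∈ S.par 1, α x y = 0) (x y : V) (a b : ℂ) :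
    (S.centralExtension α hα heven).bracket (x, a) (y, b) = (S.bracket x y, α x y) := rfl

theorem isCentralExtension_centralExtension {S : LieSuperalgebra V} {α : V →ₗ[ℂ] V →ₗ[ℂ] ℂ}
    (hα : α ∈ S.Z2) (heven : ∀ x ∈ S.par 0, ∀ y ∈ S.par 1, α x y = 0) :
    IsCentralExtension (S.centralExtension α hα heven) S (LinearMap.fst ℂ V ℂ) where
  isHom := ⟨fun _ _ hx => hx.1, fun _ _ => rfl⟩
  surjective := LinearMap.fst_surjective
  ker_even := by
    rintro ⟨x, c⟩ hx
    obtain rfl : x = 0 := hx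
    exact ⟨Submodule.zero_mem _, by simp⟩
  ker_central := by
    rintro ⟨x, c⟩ hx ⟨y, d⟩
    obtain rfl : x = 0 := hx
    simp [centralExtension_bracket]

/-- If every cocycle is a multiple of `α` up to a coboundary, and the extension defined by `α` is
perfect, then that extension is universal. -/
theorem isUniversalCentralExtension_of_isPerfect {S : LieSuperalgebra V}
    {α : V →ₗ[ℂ] V →ₗ[ℂ] ℂ} (hα : α ∈ S.Z2)
    (heven : ∀ x ∈ S.par 0, ∀ y ∈ S.par 1, α x y = 0)
    (hperf : (S.centralExtension α hα heven).IsPerfect)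
    (hcoc : ∀ (M : Type w) [AddCommGroup M] [Module ℂ M] (f : V →ₗ[ℂ] V →ₗ[ℂ] M), S.IsCocycle f →
      ∃ (k : M) (ρ : V →ₗ[ℂ] M), ∀ x y, f x y = α x y • k + ρ (S.bracket x y)) :
    IsUniversalCentralExtension.{u, u, w} (S.centralExtension α hα heven) S
      (LinearMap.fst ℂ V ℂ) := by
  refine ⟨isCentralExtension_centralExtension hα heven, ?_⟩
  intro F _ _ SF ι h
  obtain ⟨s, hpar, hs⟩ := h.exists_section
  obtain ⟨k, ρ, hρ⟩ := hcoc _ _ (isCocycle_sectionCocycle h hs hpar)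
  -- The map `ρ` need not vanish on odd vectors, whereas the kernel is even. Replacing `ρ` by `ρ ∘
  -- p0` makes the homomorphism below preserve parity.
  let p0 := Submodule.projection (S.par 0) (S.par 1) S.isCompl
  have hp0 : ∀ x ∈ S.par 0, p0 x = x := fun x hx => Submodule.projection_apply_of_mem_left _ hx
  have hp1 : ∀ x ∈ S.par 1, p0 x = 0 := fun x hx =>
    (Submodule.projection_apply_eq_zero_iff S.isCompl).2 hx
  -- For arguments of opposite parity the section cocycle is odd, yet it lies in the even kernel; so
  -- it is zero and dropping the odd part of `ρ` is harmless.
  have hodd : ∀ x y, S.bracket x y ∈ S.par 1 → α x y = 0 →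
      SF.bracket (s x) (s y) ∈ SF.par 1 →
      sectionCocycle h s hs x y = α x y • k + ρ (p0 (S.bracket x y)) := by
    intro x y h1 h2 h3
    rw [hp1 _ h1, map_zero, h2, zero_smul, add_zero]
    refine Subtype.ext (eq_zero_of_mem_par (S := SF) (h.ker_even (Subtype.prop _)) ?_)
    rw [coe_sectionCocycle]
    exact Submodule.sub_mem _ h3 (hpar 1 _ h1)
  have hmain : ∀ x y, sectionCocycle h s hs x y = α x y • k + ρ (p0 (S.bracket x y)) := by
    intro x y
    obtain ⟨x0, hx0, x1, hx1, rfl⟩ := S.exists_add_of_par x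
    obtain ⟨y0, hy0, y1, hy1, rfl⟩ := S.exists_add_of_par y
    have e00 : sectionCocycle h s hs x0 y0 = α x0 y0 • k + ρ (p0 (S.bracket x0 y0)) := by
      rw [hρ, hp0 _ (S.bracket_mem 0 0 _ _ hx0 hy0)]
    have e11 : sectionCocycle h s hs x1 y1 = α x1 y1 • k + ρ (p0 (S.bracket x1 y1)) := by
      rw [hρ, hp0 _ (S.bracket_mem 1 1 _ _ hx1 hy1)]
    have e01 := hodd x0 y1 (S.bracket_mem 0 1 _ _ hx0 hy1) (heven _ hx0 _ hy1)
      (SF.bracket_mem 0 1 _ _ (hpar _ _ hx0) (hpar _ _ hy1))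
    have e10 := hodd x1 y0 (S.bracket_mem 1 0 _ _ hx1 hy0)
      (by rw [hα.1 1 0 _ _ hx1 hy0, heven _ hy0 _ hx1, mul_zero, neg_zero])
      (SF.bracket_mem 1 0 _ _ (hpar _ _ hx1) (hpar _ _ hy0))
    simp only [map_add, LinearMap.add_apply, e00, e01, e10, e11, add_smul]
    abel
  let c : V →ₗ[ℂ] F := (LinearMap.ker ι).subtype ∘ₗ ρ ∘ₗ p0
  have hc : ∀ x, c x ∈ LinearMap.ker ι := fun x => Subtype.prop _
  -- The section is corrected by the coboundary term, and `C` goes to `k`; `hmain` is exactly the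
  -- compatibility with brackets.
  let ψ : V × ℂ →ₗ[ℂ] F := LinearMap.coprod (s + c) (LinearMap.toSpanSingleton ℂ F (k : F))
  have hψ : ∀ x a, ψ (x, a) = s x + (c x + a • (k : F)) := fun x a => by
    simp [ψ, add_assoc]
  have hz : ∀ x (a : ℂ), c x + a • (k : F) ∈ LinearMap.ker ι := fun x a =>
    Submodule.add_mem _ (hc x) (Submodule.smul_mem _ _ k.2)
  have hψhom : IsHom (S.centralExtension α hα heven) SF ψ ∧ ι ∘ₗ ψ = LinearMap.fst ℂ V ℂ := by
    refine ⟨⟨?_, ?_⟩, ?_⟩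
    · rintro p ⟨x, a⟩ ⟨hx, ha⟩
      rw [hψ]
      rcases zmod2_cases p with rfl | rfl
      · exact Submodule.add_mem _ (hpar 0 x hx) (h.ker_even (hz x a))
      · have ha0 : a = 0 := by simpa using ha
        have hc0 : c x = 0 := by simp [c, hp1 x hx]
        rw [ha0, hc0, zero_smul, add_zero, add_zero]
        exact hpar 1 x hx
    · rintro ⟨x, a⟩ ⟨y, b⟩
      rw [centralExtension_bracket, hψ, hψ, hψ, map_add, map_add, LinearMap.add_apply,
        LinearMap.add_apply, h.bracket_ker (hz y b), h.bracket_ker (hz y b),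
        h.ker_central _ (hz x a), add_zero, add_zero, add_zero, eq_comm, ← sub_eq_iff_eq_add',
        ← coe_sectionCocycle h s hs, hmain]
      simp [c, add_comm]
    · ext1
      · ext1 x
        have := hz x 0
        simp only [zero_smul, add_zero, LinearMap.mem_ker] at this
        simp [hψ, hs, this]
      · ext1
        simp [hψ]
  exact ⟨ψ, hψhom, fun φ hφ => h.hom_unique hperf hφ hψhom⟩

end Universal

end LieSuperalgebra

/-! ### Perfectness of `ℒ ⊕ ℂ C` and the dimension of `H²` -/

namespace AffineWitt

variable {g : Type u} [AddCommGroup g] [Module ℂ g] {S : LieSuperalgebra g}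

theorem cocycle_even (S : LieSuperalgebra g) :
    ∀ X ∈ S.affineWitt.par 0, ∀ Y ∈ S.affineWitt.par 1, cocycle g X Y = 0 :=
  fun _ hX _ hY => Witt.cocycle_even hX.1 hY.1

theorem isPerfect_centralExtension (hS : S.IsPerfect) :
    (S.affineWitt.centralExtension (cocycle g) (cocycle_mem_Z2 S) (cocycle_even S)).IsPerfect := by
  set P := Submodule.span ℂ {z | ∃ x y,
    (S.affineWitt.centralExtension (cocycle g) (cocycle_mem_Z2 S) (cocycle_even S)).bracket x y = z}
    with hP
  have hbr : ∀ X Y : AffineWitt g, (S.affineWitt.bracket X Y, cocycle g X Y) ∈ P := fun X Y =>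
    Submodule.subset_span ⟨(X, 0), (Y, 0), rfl⟩
  have hC : ∀ c : ℂ, ((0, c) : AffineWitt g × ℂ) ∈ P := by
    intro c
    -- In the extension `[h_1, h_{-1}] = 2C`.
    have e := Submodule.smul_mem P (c / 2) (hbr (der g (Witt.h 1)) (der g (Witt.h (-1))))
    simpa using e
  -- As `C` lies in `P`, central terms can be dropped modulo `P`: `φ` kills all brackets of `ℒ`, and
  -- it remains to reach the generators.
  let φ : AffineWitt g →ₗ[ℂ] (AffineWitt g × ℂ) ⧸ P := P.mkQ ∘ₗ LinearMap.inl ℂ (AffineWitt g) ℂ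
  have hφ : ∀ X Y, φ (S.affineWitt.bracket X Y) = 0 := by
    intro X Y
    have e := Submodule.sub_mem _ (hbr X Y) (hC (cocycle g X Y))
    simpa [φ] using e
  have hφ0 : φ = 0 := by
    have hweight : ∀ {p : ZMod 2} {i c : ℤ} {X : AffineWitt g}, Gen S p i c X → (i ≠ 0 ∨ c ≠ 0) →
        φ X = 0 := by
      intro p i c X hX h
      rcases h with h | h
      · have e := hφ (der g (Witt.d 0)) X
        rw [hX.bracket_d_zero, map_smul] at e
        exact (smul_eq_zero.1 e).resolve_left (by exact_mod_cast h)
      · have e := hφ (der g (Witt.h 0)) X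
        rw [hX.bracket_h_zero, map_smul] at e
        exact (smul_eq_zero.1 e).resolve_left (by exact_mod_cast h)
    -- Vectors of nonzero degree or charge are brackets with `d_0` or `h_0`. For the rest use `[d_1,
    -- d_{-1}] = -2 d_0`, then `[Q_1, G_{-1}] = d_0 + h_0`, and the perfectness of `𝔤` for `x ⊗ 1`.
    have hd : φ (der g (Witt.d 0)) = 0 := by
      have e := hφ (der g (Witt.d 1)) (der g (Witt.d (-1)))
      simp only [bracket_der_der, Witt.bracket_d_d, add_neg_cancel, map_smul] at e
      exact (smul_eq_zero.1 e).resolve_left (by norm_num)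
    refine hom_ext_gen (S := S) fun p i c X hX => ?_
    rw [LinearMap.zero_apply]
    rcases eq_or_ne i 0 with rfl | hi
    swap
    · exact hweight hX (Or.inl hi)
    rcases eq_or_ne c 0 with rfl | hc
    swap
    · exact hweight hX (Or.inr hc)
    cases hX with
    | d => exact hd
    | h =>
      have e := hφ (der g (Witt.Q 1)) (der g (Witt.G (-1)))
      simpa [hd] using e
    | t _ _ x hx =>
      refine LinearMap.congr_fun (hS.eq_zero (φ := φ ∘ₗ cur (t 0)) fun p q y _ z _ => ?_) x
      simpa using hφ (cur (t 0) y) (cur (t 0) z)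
  change P = ⊤
  rw [eq_top_iff]
  rintro ⟨X, c⟩ -
  have e : ((X, 0) : AffineWitt g × ℂ) ∈ P := by
    simpa [φ] using LinearMap.congr_fun hφ0 X
  simpa using Submodule.add_mem _ e (hC c)

theorem H2_eq_span (hS : S.IsPerfect) :
    S.affineWitt.H2 = Submodule.span ℂ {S.affineWitt.B2.mkQ (cocycle g)} := by
  apply le_antisymm
  · rintro _ ⟨f, hf, rfl⟩
    obtain ⟨k, ρ, h⟩ := exists_eq_cocycle_add_coboundary hS (LieSuperalgebra.isCocycle_of_mem_Z2 hf)
    refine Submodule.mem_span_singleton.2 ⟨k, ?_⟩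
    rw [← map_smul, ← sub_eq_zero, ← map_sub, Submodule.mkQ_apply, Submodule.Quotient.mk_eq_zero]
    refine ⟨-ρ, fun X Y => ?_⟩
    simp [h]; ring
  · rw [Submodule.span_singleton_le_iff_mem]
    exact ⟨_, cocycle_mem_Z2 S, rfl⟩

/-- A coboundary vanishes at `(h_1, h_{-1})`, because these elements commute in `ℒ`; the cocycle has
value `2` there. -/
theorem cocycle_notMem_B2 (S : LieSuperalgebra g) : cocycle g ∉ S.affineWitt.B2 := by
  rintro ⟨ρ, h⟩
  have e := h (der g (Witt.h 1)) (der g (Witt.h (-1)))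
  simp at e

theorem finrank_H2 (hS : S.IsPerfect) : Module.finrank ℂ S.affineWitt.H2 = 1 := by
  rw [H2_eq_span hS, finrank_span_singleton]
  rw [Submodule.mkQ_apply, Ne, Submodule.Quotient.mk_eq_zero]
  exact cocycle_notMem_B2 S

end AffineWitt

/-! ### The theorem -/

namespace SuperAffineVirasoro

variable {g : Type u} [AddCommGroup g] [Module ℂ g]

theorem d_eq (i : ℤ) : d g i = (AffineWitt.der g (Witt.d i), 0) := rfl
theorem h_eq (i : ℤ) : h g i = (AffineWitt.der g (Witt.h i), 0) := rfl
theorem Q_eq (i : ℤ) : Q g i = (AffineWitt.der g (Witt.Q i), 0) := rfl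
theorem G_eq (i : ℤ) : G g i = (AffineWitt.der g (Witt.G i), 0) := rfl
theorem C_eq : C g = (0, 1) := rfl
theorem xt_eq (x : g) (i : ℤ) : xt x i = (AffineWitt.cur (SLaurent.t i) x, 0) := rfl
theorem xtξ_eq (x : g) (i : ℤ) : xtξ x i = (AffineWitt.cur (SLaurent.tξ i) x, 0) := rfl

end SuperAffineVirasoro

end

open SuperAffineVirasoro in
theorem theorem3p1 {g : Type u} [AddCommGroup g] [Module ℂ g] [FiniteDimensional ℂ g]
    (S : LieSuperalgebra g) (hS : S.IsPerfect) :
    Module.finrank ℂ S.affineWitt.H2 = 1 ∧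
    Submodule.span ℂ (Set.range Witt.d ∪ Set.range Witt.h ∪ Set.range Witt.Q ∪ Set.range Witt.G) =
      ⊤ ∧
    ∃ (α : AffineWitt g →ₗ[ℂ] AffineWitt g →ₗ[ℂ] ℂ) (hα : α ∈ S.affineWitt.Z2)
      (heven : ∀ X ∈ S.affineWitt.par 0, ∀ Y ∈ S.affineWitt.par 1, α X Y = 0),
      -- the cocycle is supported on the Witt part
      (∀ (X Y : Witt) (u v : g ⊗[ℂ] SLaurent), α (X, u) (Y, v) = α (X, 0) (Y, 0)) ∧
      -- the extension is universal
      LieSuperalgebra.IsUniversalCentralExtension.{u, u, w}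
        (S.affineWitt.centralExtension α hα heven) S.affineWitt
        (LinearMap.fst ℂ (AffineWitt g) ℂ) ∧
      -- the brackets
      ∀ br : AffineWitt g × ℂ →ₗ[ℂ] AffineWitt g × ℂ →ₗ[ℂ] AffineWitt g × ℂ,
        br = (S.affineWitt.centralExtension α hα heven).bracket →
        (∀ X : AffineWitt g × ℂ, br (C g) X = 0) ∧
        (∀ i j : ℤ,
          br (d g i) (d g j) = ((j : ℂ) - i) • d g (i + j) ∧
          br (d g i) (h g j) =
            (j : ℂ) • h g (i + j) - (if i + j = 0 then (i : ℂ) ^ 2 else 0) • C g ∧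
          br (d g i) (Q g j) = (j : ℂ) • Q g (i + j) ∧
          br (d g i) (G g j) = ((j : ℂ) - i) • G g (i + j) ∧
          br (h g i) (h g j) = (if i + j = 0 then 2 * (i : ℂ) else 0) • C g ∧
          br (h g i) (Q g j) = -Q g (i + j) ∧
          br (h g i) (G g j) = G g (i + j) ∧
          br (Q g i) (Q g j) = 0 ∧
          br (Q g i) (G g j) =
            d g (i + j) + (i : ℂ) • h g (i + j) - (if i + j = 0 then (i : ℂ) ^ 2 else 0) • C g ∧
          br (G g i) (G g j) = 0) ∧
        (∀ (p : ZMod 2) (x : g), x ∈ S.par p → ∀ i j : ℤ,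
          br (d g i) (xt x j) = (j : ℂ) • xt x (i + j) ∧
          br (d g i) (xtξ x j) = (j : ℂ) • xtξ x (i + j) ∧
          br (h g i) (xt x j) = 0 ∧
          br (h g i) (xtξ x j) = xtξ x (i + j) ∧
          br (Q g i) (xt x j) = 0 ∧
          br (Q g i) (xtξ x j) = ksign 1 p • xt x (i + j) ∧
          br (G g i) (xt x j) = (ksign 1 p * (j : ℂ)) • xtξ x (i + j) ∧
          br (G g i) (xtξ x j) = 0) ∧
        (∀ (x : g) (q : ZMod 2) (y : g), y ∈ S.par q → ∀ i j : ℤ,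
          br (xt x i) (xt y j) = xt (S.bracket x y) (i + j) ∧
          br (xtξ x i) (xt y j) = ksign 1 q • xtξ (S.bracket x y) (i + j) ∧
          br (xtξ x i) (xtξ y j) = 0) := by
  refine ⟨AffineWitt.finrank_H2 hS, Witt.span_eq_top, AffineWitt.cocycle g,
    AffineWitt.cocycle_mem_Z2 S, AffineWitt.cocycle_even S, fun X Y a b => rfl, ?_, ?_⟩
  -- The coefficient space `M` will be the kernel of an arbitrary central extension of `ℒ`.
  · exact LieSuperalgebra.isUniversalCentralExtension_of_isPerfect _ _
      (AffineWitt.isPerfect_centralExtension hS)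
      fun M _ _ f hf => AffineWitt.exists_eq_cocycle_add_coboundary hS hf
  · rintro br rfl
    refine ⟨?_, fun i j => ?_, fun p x hx i j => ?_, fun x q y hy i j => ?_⟩
    · rintro ⟨X, a⟩
      simp [C_eq, LieSuperalgebra.centralExtension_bracket]
    · refine ⟨?_, ?_, ?_, ?_, ?_, ?_, ?_, ?_, ?_, ?_⟩ <;>
        simp [d_eq, h_eq, Q_eq, G_eq, C_eq, LieSuperalgebra.centralExtension_bracket] <;>
        split_ifs <;> simp
    · refine ⟨?_, ?_, ?_, ?_, ?_, ?_, ?_, ?_⟩ <;>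
        simp [d_eq, h_eq, Q_eq, G_eq, C_eq, xt_eq, xtξ_eq, S.parityMap_of_mem hx, smul_smul,
          mul_comm, LieSuperalgebra.centralExtension_bracket]
    · refine ⟨?_, ?_, ?_⟩ <;>
        simp [xt_eq, xtξ_eq, S.parityMap_of_mem hy, LieSuperalgebra.centralExtension_bracket]
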